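/- For a field $F$, let $D(4,F)$ be the bipartite graph whose vertices are points $P=(p_1,p_2,p_3,p_4)\in F^4$ and lines $L=(\ell_1,\ell_2,\ell_3,\ell_4)\in F^4$ (two disjoint copies of $F^4$), with $P$ adjacent to $L$ iff $p_2+\ell_2=p_1\ell_1$, $p_3+\ell_3=p_1\ell_2$ and $p_4+\ell_4=p_2\ell_1$. For an odd prime $p$, let $\Gamma(4,p)$ be the graph whose vertices are the $p^4$ points of $D(4,\mathbb F_p)$, two points being adjacent iff they are distinct and some line is adjacent to both of them in $D(4,\mathbb F_p)$. Let $A$ be its adjacency matrix and $\phi(x)=\det(xI_{p^4}-A)$. Let $\zeta\in\mathbb C$ be any primitive $p$-th root of unity, and for $f:\mathbb F_p\to\mathbb F_p$ put $\varepsilon_f=\sum_{a\in\mathbb F_p}\zeta^{f(a)}$. (i) If $p=3$, then $\phi(x)=x^{18}(x-6)(x-3)^{12}(x+3)^{14}(x^3-9x-9)^{12}$. (ii) If $p=5$, then $\phi(x)=x^{220}(x-20)(x-5)^{80}(x+5)^{164}(x^2-5x-25)^{80}$. (iii) If $p>5$ and $p\equiv2\pmod 3$, then $$\phi(x)=x^{3p(p-1)}\,(x-p(p-1))\,(x-p)^{p(p-1)^2}\,(x+p)^{(p-1)(2p^2-2p+1)}\prod_{c=1}^{p-1}\bigl(x+p-\varepsilon_{t^3+ct}^2\bigr)^{p(p-1)^2},$$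 and $\phi$ has exactly $p+3$ distinct complex roots, with multiplicities as indicated by the exponents; that is, the numbers $0$, $p(p-1)$, $p$, $-p$ and $\varepsilon_{t^3+ct}^2-p$ ($1\le c\le p-1$) are pairwise distinct, and each is a root of $\phi$ of multiplicity exactly the displayed exponent of the corresponding factor. (iv) If $p\equiv1\pmod 3$ and $\omega$ is any generator of the multiplicative group $\mathbb F_p^\times$, then $$\phi(x)=x^{3p(p-1)}\,(x-p(p-1))\,(x-p)^{p(p-1)^2}\,(x+p)^{(p-1)(p^2-p+1)}\Bigl[\prod_{i=0}^{2}\bigl(x+p-\varepsilon_{\omega^i t^3}^2\bigr)\Bigr]^{p(p-1)^2/3}\prod_{a=1}^{p-1}\bigl(x+p-\varepsilon_{at^3+t}^2\bigr)^{p(p-1)^2},$$ and $\phi$ has exactly $p+6$ distinct complex roots, with multiplicities as indicated by the exponents; that is, the numbers $0$, $p(p-1)$, $p$, $-p$, $\varepsilon_{\omega^i t^3}^2-p$ ($0\le i\le 2$) and $\varepsilon_{at^3+t}^2-p$ ($1\le a\le p-1$) are pairwise distinct, and each is a root of $\phi$ of multiplicity exactly the displayed exponent of the corresponding factor. -/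

import Mathlib

open Polynomial

/-- Incidence of the point `P(p₁,p₂,p₃,p₄)` and the line `L(ℓ₁,ℓ₂,ℓ₃,ℓ₄)` of `D(4,F)`:
`p₂ + ℓ₂ = p₁ℓ₁`, `p₃ + ℓ₃ = p₁ℓ₂` and `p₄ + ℓ₄ = p₂ℓ₁`.
The coordinates `1, 2, 3, 4` are indexed by `0, 1, 2, 3 : Fin 4`. -/
def D4Incident {F : Type*} [Field F] (P L : Fin 4 → F) : Prop :=
  P 1 + L 1 = P 0 * L 0 ∧ P 2 + L 2 = P 0 * L 1 ∧ P 3 + L 3 = P 1 * L 0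

/-- The bipartite graph `D(4,F)`: the points are the vertices `Sum.inl P`, the lines are the
vertices `Sum.inr L`, and adjacency is incidence. -/
def graphD4 (F : Type*) [Field F] : SimpleGraph ((Fin 4 → F) ⊕ (Fin 4 → F)) where
  Adj
    | .inl P, .inr L => D4Incident P L
    | .inr L, .inl P => D4Incident P L
    | _, _ => False
  symm := ⟨by rintro (P | L) (P' | L') h <;> exact h⟩
  loopless := ⟨by rintro (P | L) h <;> exact h⟩

/-- The point collinearity graph `Γ(4,F)` of `D(4,F)`: the vertices are the points, and two points
are adjacent iff they are distinct and some line is incident with both. -/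
def graphGamma4 (F : Type*) [Field F] : SimpleGraph (Fin 4 → F) where
  Adj P Q := P ≠ Q ∧ ∃ L : Fin 4 → F,
    (graphD4 F).Adj (.inl P) (.inr L) ∧ (graphD4 F).Adj (.inl Q) (.inr L)
  symm := ⟨fun _ _ h => ⟨h.1.symm, h.2.imp fun _ hL => ⟨hL.2, hL.1⟩⟩⟩
  loopless := ⟨fun _ h => h.1 rfl⟩

open Classical in
/-- The characteristic polynomial `φ(x) = det(xI - A)` of the adjacency matrix `A` of `Γ(4,F)`. -/
noncomputable def phiGamma4 (F : Type*) [Field F] [Fintype F] : ℂ[X] :=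
  ((graphGamma4 F).adjMatrix ℂ).charpoly

/-- The exponential sum `ε_f = ∑_{a ∈ 𝔽_p} ζ ^ f(a)` of a function `f : 𝔽_p → 𝔽_p`
(over a prime field the absolute trace is the identity), where `ζ` is a `p`-th root of unity,
so that the exponent only matters modulo `p`. -/
noncomputable def expSum {p : ℕ} [Fact p.Prime] (ζ : ℂ) (f : ZMod p → ZMod p) : ℂ :=
  ∑ a : ZMod p, ζ ^ (f a).val

/-!
The collinearity graph `Γ(4,F)` joins `P` to the points `P + (s, st, s(p₁t - p₂), st²)` with
`s ≠ 0`. It is a Cayley graph of the product of the Heisenberg group and the additive group of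
`F`. In the coordinates `p₂`, `p₃ - p₁p₂`, `p₄`, `p₁` its adjacency matrix `A` commutes with the
translations in the last three coordinates. The Fourier transform on `F⁴` therefore splits `A + q`
into `q × q` blocks, one for each triple of frequencies `(γ, δ, η)`
(`phiGamma4_eq_prod_charpoly`).

For `γ = 0` the block is diagonal with entries `q · #{t | δt² + ut + η = 0}`, and for `γ ≠ 0`,
`δ = 0` it is essentially `q` times the incidence matrix of `v² = w²`. These blocks account for the
eigenvalues `0`, `q(q-1)` and `±q` of `A` (`phiGamma4_eq`). For `γδ ≠ 0` the entries of the block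
are sums over `t` of `ψ(γ(v² - w²)t + δ(v - w)t² + η(v - w))`. When `3` is invertible, completing
the cube turns this into a convolution matrix conjugated by a diagonal matrix, whose eigenvalues
are the squares of the sums `∑ ψ(at³ + ct)`, where `a = γ²/(3δ)` and `c ∈ F`
(`charpoly_cubicBlock`). Rescaling `t` then normalizes the coefficients, in a way that depends on
whether every element of `𝔽_p` is a cube. For `p = 3` the block is an explicit `3 × 3` matrix, and
for `p = 5` the sums are computed in `ℚ(√5)`.

Distinctness of the eigenvalues rests on one observation. An integral linear relation between the
`p`-th roots of unity has constant coefficients, so that it forces all power sums of its exponents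
of order less than `p - 1` to vanish modulo `p`
(`sum_mul_pow_eq_zero_of_sum_mul_root_pow_eq_zero`). Hence `ε_f²` determines the power sums of `f`
up to sign, and it is not an integer multiple of `p` if the first nonzero power sum of `f` has
order less than `(p - 1)/2` (`expSum_sq_ne_mul`). For `f = at³ + bt` the first two nonzero power
sums are multiples of monomials in `a` and `b` (up to one extra term for `p = 7`), and these
separate the sums in question as soon as `p > 5`.
-/

/-! ### Similarity and block-diagonal matrices -/

theorem Matrix.charpoly_eq_of_mul_eq_mul {n K : Type*} [Fintype n] [DecidableEq n] [Field K]
    {A B V W : Matrix n n K} {c : K} (hc : c ≠ 0) (hVW : V * W = c • (1 : Matrix n n K))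
    (h : A * V = V * B) : A.charpoly = B.charpoly := by
  have hV : V * (c⁻¹ • W) = 1 := by
    rw [Matrix.mul_smul, hVW, smul_smul, inv_mul_cancel₀ hc, one_smul]
  let U : (Matrix n n K)ˣ := ⟨V, c⁻¹ • W, hV, mul_eq_one_comm.mp hV⟩
  have hA : A = U.val * B * U⁻¹.val := (Units.eq_mul_inv_iff_mul_eq U).2 h
  rw [hA, Matrix.coe_units_inv]
  exact Matrix.charpoly_units_conj U B

theorem Matrix.charpoly_blockDiagonal {n o K : Type*} [Fintype n] [DecidableEq n] [Fintype o]
    [DecidableEq o] [CommRing K] (M : o → Matrix n n K) :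
    (Matrix.blockDiagonal M).charpoly = ∏ i, (M i).charpoly := by
  have : (Matrix.blockDiagonal M).charmatrix = Matrix.blockDiagonal fun i => (M i).charmatrix := by
    ext ⟨i, k⟩ ⟨j, l⟩
    simp only [Matrix.charmatrix_apply, Matrix.blockDiagonal_apply, Matrix.diagonal_apply,
      Prod.mk.injEq]
    by_cases hk : k = l <;> simp [hk]
  rw [Matrix.charpoly, this, Matrix.det_blockDiagonal]
  rfl

/-! ### Fourier matrices -/

section Fourier

variable {F : Type*} [Field F] [Fintype F] [DecidableEq F]

theorem AddChar.IsPrimitive.sum_mul_apply_eq_ite {ψ : AddChar F ℂ} (hψ : ψ.IsPrimitive) (b : F) :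
    ∑ x, ψ (x * b) = if b = 0 then (Fintype.card F : ℂ) else 0 := by
  rw [AddChar.sum_mulShift b hψ]
  split_ifs <;> simp

/-- A matrix of counts of a two-parameter family of maps acts on functions by summing over the
family. -/
theorem sum_sum_ite_eq_comp {α β γ M : Type*} [Fintype α] [Fintype β] [Fintype γ] [DecidableEq γ]
    [NonAssocSemiring M] (τ : α → β → γ) (f : γ → M) :
    ∑ k, (∑ s, ∑ t, if k = τ s t then (1 : M) else 0) * f k = ∑ s, ∑ t, f (τ s t) := by
  simp only [Finset.sum_mul]
  rw [Finset.sum_comm]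
  refine Finset.sum_congr rfl fun s _ => ?_
  rw [Finset.sum_comm]
  simp

end Fourier

/-! ### The collinearity graph in twisted coordinates -/

section Graph

variable {F : Type*} [Field F]

/-- Coordinates `(p₂, (p₃ - p₁p₂, p₄, p₁))` on the points of `D(4,F)`. In these coordinates the
collinearity relation commutes with all translations that fix the coordinate `p₂`. -/
def pointCoords (F : Type*) [Field F] : F × (F × F × F) ≃ (Fin 4 → F) where
  toFun k := ![k.2.2.2, k.1, k.2.1 + k.2.2.2 * k.1, k.2.2.1]
  invFun P := (P 1, (P 2 - P 0 * P 1, P 3, P 0))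
  left_inv k := by simp
  right_inv P := by
    ext i
    fin_cases i <;> simp

/-- The point reached from `k` along the line through `k` with first coordinate `t`, when the
coordinate `p₁` increases by `s`. -/
def lineStep (s t : F) (k : F × (F × F × F)) : F × (F × F × F) :=
  (k.1 + s * t, (k.2.1 - 2 * k.1 * s - s ^ 2 * t, k.2.2.1 + s * t ^ 2, k.2.2.2 + s))

theorem graphGamma4_adj_pointCoords_iff (k k' : F × (F × F × F)) :
    (graphGamma4 F).Adj (pointCoords F k) (pointCoords F k') ↔
      k ≠ k' ∧ ∃ s t, k' = lineStep s t k := by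
  obtain ⟨y, z, d, x⟩ := k
  obtain ⟨y', z', d', x'⟩ := k'
  simp only [graphGamma4, graphD4, D4Incident, pointCoords, lineStep, Equiv.coe_fn_mk, ne_eq,
    Prod.mk.injEq]
  refine and_congr ?_ ?_
  · rw [not_iff_not]
    constructor
    · intro h
      have h0 := congrFun h 0
      have h1 := congrFun h 1
      have h2 := congrFun h 2
      have h3 := congrFun h 3
      simp at h0 h1 h2 h3
      subst h0 h1 h3
      simpa using h2
    · rintro ⟨rfl, rfl, rfl, rfl⟩
      rfl
  · constructor
    · rintro ⟨L, ⟨h1, h2, h3⟩, h1', h2', h3'⟩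
      refine ⟨x' - x, L 0, ?_, ?_, ?_, ?_⟩
      all_goals simp at h1 h2 h3 h1' h2' h3'
      · linear_combination h1' - h1
      · have e : L 1 = x * L 0 - y := by linear_combination h1
        have e' : y' = y + (x' - x) * L 0 := by linear_combination h1' - h1
        rw [e] at h2 h2'
        rw [e'] at h2'
        linear_combination h2' - h2
      · linear_combination h3' - h3 + L 0 * (h1' - h1)
      · ring
    · rintro ⟨s, t, rfl, rfl, rfl, rfl⟩
      refine ⟨![t, x * t - y, x * (x * t - y) - (z + x * y), y * t - d], ?_, ?_⟩
      · simp
      · simp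
        refine ⟨?_, ?_, ?_⟩ <;> ring

theorem lineStep_eq_self_iff (s t : F) (k : F × (F × F × F)) : k = lineStep s t k ↔ s = 0 := by
  obtain ⟨y, z, d, x⟩ := k
  simp only [lineStep, Prod.mk.injEq]
  constructor
  · rintro ⟨-, -, -, h⟩
    simpa using h
  · rintro rfl
    simp

variable [Fintype F] [DecidableEq F]

open Classical in
/-- The entries of `A + q` count the pairs `(s, t)` that lead from one point to the other. -/
theorem adjMatrix_pointCoords_add (k k' : F × (F × F × F)) :
    ((graphGamma4 F).adjMatrix ℂ) (pointCoords F k) (pointCoords F k') +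
      (if k = k' then (Fintype.card F : ℂ) else 0) =
    ∑ s, ∑ t, if k' = lineStep s t k then (1 : ℂ) else 0 := by
  rw [SimpleGraph.adjMatrix_apply]
  simp only [graphGamma4_adj_pointCoords_iff]
  by_cases hk : k = k'
  · subst hk
    simp [lineStep_eq_self_iff]
  · by_cases h : ∃ s t, k' = lineStep s t k
    · obtain ⟨s, t, rfl⟩ := h
      have hs : s ≠ 0 := fun hs => hk ((lineStep_eq_self_iff s t k).2 hs)
      have key : ∀ s' t', lineStep s t k = lineStep s' t' k ↔ s = s' ∧ t = t' := by
        intro s' t'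
        constructor
        · intro h
          simp only [lineStep, Prod.mk.injEq, add_right_inj] at h
          obtain ⟨h1, -, -, h4⟩ := h
          subst h4
          exact ⟨rfl, mul_left_cancel₀ hs h1⟩
        · rintro ⟨rfl, rfl⟩
          rfl
      rw [if_pos ⟨hk, s, t, rfl⟩, if_neg hk, add_zero]
      simp only [key, ite_and]
      simp only [Finset.sum_ite_irrel, Finset.sum_const_zero, Finset.sum_ite_eq, Finset.mem_univ,
        if_true]
    · rw [if_neg (fun h' => h h'.2), if_neg hk, add_zero]
      push Not at h
      simp [h]

/-- The pairing of coordinates with frequencies. -/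
def coordPairing (k κ : F × (F × F × F)) : F :=
  κ.1 * k.1 + κ.2.1 * k.2.1 + κ.2.2.1 * k.2.2.1 + κ.2.2.2 * k.2.2.2

/-- The Fourier matrix of the group `F⁴`. -/
noncomputable def fourierMatrix (ψ : AddChar F ℂ) :
    Matrix (F × (F × F × F)) (F × (F × F × F)) ℂ :=
  fun k κ => ψ (coordPairing k κ)

/-- Orthogonality of characters: up to a scalar, the conjugate transpose inverts the matrix. -/
theorem fourierMatrix_mul_inv {ψ : AddChar F ℂ} (hψ : ψ.IsPrimitive) :
    fourierMatrix ψ * (Matrix.of fun κ k => ψ (-coordPairing k κ)) =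
      ((Fintype.card F : ℂ) ^ 4) • (1 : Matrix (F × (F × F × F)) (F × (F × F × F)) ℂ) := by
  ext ⟨y, z, d, x⟩ ⟨y', z', d', x'⟩
  rw [Matrix.mul_apply, Matrix.smul_apply, Matrix.one_apply]
  simp only [fourierMatrix, Matrix.of_apply, coordPairing, Fintype.sum_prod_type]
  have h : ∀ a b c e : F,
      ψ (a * y + b * z + c * d + e * x) * ψ (-(a * y' + b * z' + c * d' + e * x')) =
        ψ (a * (y - y')) * (ψ (b * (z - z')) * (ψ (c * (d - d')) * ψ (e * (x - x')))) := by
    intro a b c e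
    simp only [← AddChar.map_add_eq_mul]
    congr 1
    ring
  simp only [h, ← Finset.mul_sum, ← Finset.sum_mul, hψ.sum_mul_apply_eq_ite, sub_eq_zero,
    Prod.mk.injEq]
  split_ifs <;> simp_all
  ring

/-- The block of `A + q` on the functions with frequencies `(γ, δ, η)` in the coordinates
`(p₃ - p₁p₂, p₄, p₁)`; its rows and columns are indexed by the frequencies in `p₂`. -/
noncomputable def gammaBlock (ψ : AddChar F ℂ) (o : F × F × F) : Matrix F F ℂ :=
  fun w u => ∑ s, ∑ t, if w = u - 2 * o.1 * s then
    ψ (-o.1 * s ^ 2 * t + o.2.1 * s * t ^ 2 + o.2.2 * s + u * s * t) else 0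

open Classical in
/-- Translations in `p₃ - p₁p₂`, `p₄` and `p₁` commute with `A`, hence the Fourier matrix makes `A`
block diagonal. -/
theorem phiGamma4_eq_prod_charpoly {ψ : AddChar F ℂ} (hψ : ψ.IsPrimitive) :
    phiGamma4 F = ∏ o : F × F × F,
      (gammaBlock ψ o - (Fintype.card F : ℂ) • (1 : Matrix F F ℂ)).charpoly := by
  have hq : (Fintype.card F : ℂ) ≠ 0 := Nat.cast_ne_zero.2 Fintype.card_ne_zero
  have hphi : phiGamma4 F = ((graphGamma4 F).adjMatrix ℂ).charpoly := by
    unfold phiGamma4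
    congr!
  rw [← Matrix.charpoly_blockDiagonal, hphi, ← Matrix.charpoly_reindex (pointCoords F).symm]
  refine Matrix.charpoly_eq_of_mul_eq_mul (pow_ne_zero 4 hq) (fourierMatrix_mul_inv hψ) ?_
  have hA : Matrix.reindex (pointCoords F).symm (pointCoords F).symm ((graphGamma4 F).adjMatrix ℂ) =
      (Matrix.of fun k k' => ∑ s, ∑ t, if k' = lineStep s t k then (1 : ℂ) else 0) -
        (Fintype.card F : ℂ) • 1 := by
    ext k k'
    rw [Matrix.sub_apply, Matrix.of_apply, ← adjMatrix_pointCoords_add, Matrix.smul_apply,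
      Matrix.one_apply, Matrix.reindex_apply, Matrix.submatrix_apply]
    simp
  have hB : Matrix.blockDiagonal
      (fun o => gammaBlock ψ o - (Fintype.card F : ℂ) • (1 : Matrix F F ℂ)) =
      Matrix.blockDiagonal (gammaBlock ψ) - (Fintype.card F : ℂ) • 1 := by
    rw [← Matrix.blockDiagonal_one, ← Matrix.blockDiagonal_smul, ← Matrix.blockDiagonal_sub]
    rfl
  rw [hA, hB, Matrix.sub_mul, Matrix.mul_sub, Matrix.smul_mul, Matrix.mul_smul, Matrix.one_mul,
    Matrix.mul_one]
  congr 1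
  ext k ⟨u, o⟩
  rw [Matrix.mul_apply, Matrix.mul_apply]
  simp only [Matrix.of_apply]
  rw [sum_sum_ite_eq_comp (fun s t => lineStep s t k) (fun k' => fourierMatrix ψ k' (u, o))]
  rw [Fintype.sum_prod_type]
  simp only [Matrix.blockDiagonal_apply, mul_ite, mul_zero, Finset.sum_ite_eq', Finset.mem_univ,
    if_true, gammaBlock, Finset.mul_sum]
  symm
  rw [Finset.sum_comm]
  refine Finset.sum_congr rfl fun s _ => ?_
  rw [Finset.sum_comm]
  refine Finset.sum_congr rfl fun t _ => ?_
  simp only [Finset.sum_ite_eq', Finset.mem_univ, if_true]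
  rw [fourierMatrix, fourierMatrix, ← AddChar.map_add_eq_mul]
  congr 1
  simp only [coordPairing, lineStep]
  ring

end Graph

/-! ### Products over a finite field -/

section Products

variable {F : Type*} [Field F] [Fintype F] [DecidableEq F]

theorem Fintype.prod_eq_mul_prod_units {M : Type*} [CommMonoid M] (f : F → M) :
    ∏ x, f x = f 0 * ∏ u : Fˣ, f u := by
  rw [Fintype.prod_eq_mul_prod_subtype_ne f 0]
  congr 1
  exact (Fintype.prod_equiv unitsEquivNeZero _ _ fun u => rfl).symm

/-- A `±1`-valued function on the nonzero elements with vanishing sum takes both values equally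
often. It is used for the quadratic character and for a choice of signs that is odd. -/
theorem prod_comp_of_sum_eq_zero {M : Type*} [CommMonoid M] {σ : F → ℤ} (h0 : σ 0 = 0)
    (h1 : ∀ u, u ≠ 0 → σ u = 1 ∨ σ u = -1) (hsum : ∑ u, σ u = 0) (g : ℤ → M) :
    ∏ u, g (σ u) = g 0 * (g 1 * g (-1)) ^ ((Fintype.card F - 1) / 2) := by
  rw [Fintype.prod_eq_mul_prod_units, h0]
  congr 1
  have h1' : ∀ u : Fˣ, σ u = 1 ∨ σ u = -1 := fun u => h1 u u.ne_zero
  have hsum' : ∑ u : Fˣ, σ u = 0 := by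
    have h := Fintype.prod_eq_mul_prod_units (fun u : F => Multiplicative.ofAdd (σ u))
    rw [← ofAdd_sum, ← ofAdd_sum, h0, hsum, ofAdd_zero, one_mul] at h
    exact (Multiplicative.ofAdd.injective h).symm
  set n := (Finset.univ.filter fun u : Fˣ => σ u = 1).card with hn
  set m := (Finset.univ.filter fun u : Fˣ => ¬ σ u = 1).card with hm
  have hσ : ∀ u ∈ Finset.univ.filter fun u : Fˣ => ¬ σ u = 1, σ u = -1 := by
    intro u hu
    exact (h1' u).resolve_left (Finset.mem_filter.1 hu).2
  have hnm : n + m = Fintype.card F - 1 := by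
    rw [← Fintype.card_units, ← Finset.card_univ]
    exact Finset.card_filter_add_card_filter_not _
  have hsub : (n : ℤ) - m = 0 := by
    rw [← Finset.sum_filter_add_sum_filter_not _ (fun u : Fˣ => σ u = 1),
      Finset.sum_congr rfl fun u hu => (Finset.mem_filter.1 hu).2, Finset.sum_congr rfl hσ] at hsum'
    simp only [Finset.sum_const, nsmul_eq_mul, mul_one, mul_neg] at hsum'
    linarith
  have e1 : n = (Fintype.card F - 1) / 2 := by omega
  have e2 : m = (Fintype.card F - 1) / 2 := by omega
  have hp : ∏ u ∈ Finset.univ.filter (fun u : Fˣ => σ u = 1), g (σ u) = g 1 ^ n :=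
    Finset.prod_eq_pow_card fun u hu => by rw [(Finset.mem_filter.1 hu).2]
  have hm' : ∏ u ∈ Finset.univ.filter (fun u : Fˣ => ¬ σ u = 1), g (σ u) = g (-1) ^ m :=
    Finset.prod_eq_pow_card fun u hu => by rw [hσ u hu]
  rw [← Finset.prod_filter_mul_prod_filter_not _ (fun u : Fˣ => σ u = 1), hp, hm', e1, e2, mul_pow]

omit [DecidableEq F] in
/-- In odd characteristic one element can be chosen from each pair `{u, -u}` with `u ≠ 0`; the
choice is recorded by an odd function with values `±1` off `0`. -/
theorem exists_odd_sign (hF : ringChar F ≠ 2) : ∃ σ : F → ℤ, (∀ u, σ (-u) = -σ u) ∧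
    ∀ u, u ≠ 0 → σ u = 1 ∨ σ u = -1 := by
  let e := Fintype.equivFin F
  refine ⟨fun u => Int.sign ((e (-u) : ℤ) - e u), fun u => ?_, fun u hu => ?_⟩
  · simp only [neg_neg, ← Int.sign_neg, neg_sub]
  · have h : (e (-u) : ℤ) - e u ≠ 0 := by
      intro h
      have h' : e (-u) = e u := Fin.ext (by omega)
      have h2 : (2 : F) ≠ 0 := Ring.two_ne_zero hF
      have h3 := e.injective h'
      have h4 : 2 * u = 0 := by linear_combination -h3
      exact hu ((mul_eq_zero.1 h4).resolve_left h2)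
    rcases lt_or_gt_of_ne h with h | h
    · exact Or.inr (Int.sign_eq_neg_one_of_neg h)
    · exact Or.inl (Int.sign_eq_one_of_pos h)

end Products

/-! ### The diagonal blocks -/

section Blocks

variable {F : Type*} [Field F] [Fintype F] [DecidableEq F]

/-- For `γ = 0` the block of `A + q` is diagonal, and its entries are `q` times the number of roots
of `δt² + ut + η`. -/
theorem charpoly_gammaBlock_zero {ψ : AddChar F ℂ} (hψ : ψ.IsPrimitive) (δ η : F) :
    (gammaBlock ψ (0, δ, η) - (Fintype.card F : ℂ) • (1 : Matrix F F ℂ)).charpoly =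
      ∏ u, (X - C ((Fintype.card F : ℂ) *
        ((Finset.univ.filter fun t => δ * t ^ 2 + u * t + η = 0).card - 1))) := by
  rw [← Matrix.charpoly_diagonal]
  congr 1
  ext w u
  rw [Matrix.sub_apply, Matrix.smul_apply, Matrix.one_apply, Matrix.diagonal_apply, gammaBlock]
  by_cases h : w = u
  · subst h
    simp only [mul_zero, zero_mul, sub_zero, if_true, neg_zero, zero_add]
    rw [Finset.sum_comm]
    have : ∀ t s : F, ψ (δ * s * t ^ 2 + η * s + w * s * t) =
        ψ (s * (δ * t ^ 2 + w * t + η)) := fun t s => by congr 1; ring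
    simp only [this, hψ.sum_mul_apply_eq_ite]
    rw [← Finset.sum_filter, Finset.sum_const]
    simp only [nsmul_eq_mul, smul_eq_mul]
    ring
  · simp [h]

/-- The block of `A + q` with `p₃`-frequency `γ ≠ 0` after the substitution `u = 2γv` in the
index. -/
noncomputable def cubicBlock (ψ : AddChar F ℂ) (γ δ η : F) : Matrix F F ℂ :=
  fun w v => ∑ t, ψ (γ * (v ^ 2 - w ^ 2) * t + δ * (v - w) * t ^ 2 + η * (v - w))

theorem charpoly_gammaBlock_of_ne_zero (hF : ringChar F ≠ 2) (ψ : AddChar F ℂ) {γ : F} (hγ : γ ≠ 0)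
    (δ η : F) :
    (gammaBlock ψ (γ, δ, η) - (Fintype.card F : ℂ) • (1 : Matrix F F ℂ)).charpoly =
      (cubicBlock ψ γ δ η - (Fintype.card F : ℂ) • (1 : Matrix F F ℂ)).charpoly := by
  have h2 : 2 * γ ≠ 0 := mul_ne_zero (Ring.two_ne_zero hF) hγ
  rw [← Matrix.charpoly_reindex (Equiv.mulLeft₀ (2 * γ) h2)
    (cubicBlock ψ γ δ η - (Fintype.card F : ℂ) • (1 : Matrix F F ℂ))]
  congr 1
  ext w u
  obtain ⟨w, rfl⟩ := (Equiv.mulLeft₀ (2 * γ) h2).surjective w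
  obtain ⟨v, rfl⟩ := (Equiv.mulLeft₀ (2 * γ) h2).surjective u
  rw [Matrix.reindex_apply, Matrix.submatrix_apply, Equiv.symm_apply_apply, Equiv.symm_apply_apply,
    Matrix.sub_apply, Matrix.sub_apply, Matrix.smul_apply, Matrix.smul_apply, Matrix.one_apply,
    Matrix.one_apply]
  simp only [EmbeddingLike.apply_eq_iff_eq]
  congr 1
  simp only [Equiv.mulLeft₀_apply, gammaBlock, cubicBlock]
  have key : ∀ s : F, 2 * γ * w = 2 * γ * v - 2 * γ * s ↔ s = v - w := by
    intro s
    rw [← mul_sub, mul_right_inj' h2]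
    constructor <;> (intro h; rw [h]; ring)
  simp only [key]
  rw [Finset.sum_comm]
  refine Finset.sum_congr rfl fun t _ => ?_
  rw [Finset.sum_ite_eq']
  simp only [Finset.mem_univ, if_true]
  congr 1
  ring

theorem charpoly_sub_smul_of_mul_eq_mul {n : Type*} [Fintype n] [DecidableEq n]
    {M V W : Matrix n n ℂ} {d : n → ℂ} {c : ℂ} (hc : c ≠ 0)
    (hVW : V * W = c • (1 : Matrix n n ℂ)) (h : M * V = V * Matrix.diagonal d) (q : ℂ) :
    (M - q • (1 : Matrix n n ℂ)).charpoly = ∏ u, (X - C (d u - q)) := by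
  rw [← Matrix.charpoly_diagonal]
  refine Matrix.charpoly_eq_of_mul_eq_mul hc hVW ?_
  have : Matrix.diagonal (fun u => d u - q) = Matrix.diagonal d - q • (1 : Matrix n n ℂ) := by
    rw [Matrix.smul_one_eq_diagonal, Matrix.diagonal_sub]
  rw [this, Matrix.sub_mul, Matrix.mul_sub, h, Matrix.smul_mul, Matrix.mul_smul, Matrix.one_mul,
    Matrix.mul_one]

/-- For `δ = 0` the block of `A + q` is, up to a diagonal conjugation, `q` times the incidence
matrix of the relation `v² = w²`. Let `σ` be an odd choice of signs; the vectors
`e_c + σ(c) e_{-c}` are eigenvectors with eigenvalues `q(1 + σ(c))`. -/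
theorem charpoly_cubicBlock_zero (hF : ringChar F ≠ 2) {ψ : AddChar F ℂ} (hψ : ψ.IsPrimitive)
    {γ : F} (hγ : γ ≠ 0) (η : F) :
    (cubicBlock ψ γ 0 η - (Fintype.card F : ℂ) • (1 : Matrix F F ℂ)).charpoly =
      X * ((X - C (Fintype.card F : ℂ)) * (X + C (Fintype.card F : ℂ))) ^
        ((Fintype.card F - 1) / 2) := by
  obtain ⟨σ, hodd, hsign⟩ := exists_odd_sign hF
  have h0 : σ 0 = 0 := by
    have := hodd 0
    rw [neg_zero] at this
    omega
  have hsum : ∑ u, σ u = 0 := by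
    have h : ∑ u, σ (-u) = ∑ u, σ u := Equiv.sum_comp (Equiv.neg F) σ
    simp only [hodd, Finset.sum_neg_distrib] at h
    omega
  have h2 : (2 : F) ≠ 0 := Ring.two_ne_zero hF
  have hneg : ∀ u : F, u = -u ↔ u = 0 := by
    intro u
    constructor
    · intro h
      have h4 : 2 * u = 0 := by linear_combination h
      exact (mul_eq_zero.1 h4).resolve_left h2
    · rintro rfl
      simp
  have hM : ∀ w v, cubicBlock ψ γ 0 η w v =
      if v = w ∨ v = -w then (Fintype.card F : ℂ) * ψ (η * (v - w)) else 0 := by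
    intro w v
    have : ∀ t : F, ψ (γ * (v ^ 2 - w ^ 2) * t + 0 * (v - w) * t ^ 2 + η * (v - w)) =
        ψ (t * (γ * (v ^ 2 - w ^ 2))) * ψ (η * (v - w)) := by
      intro t
      rw [← AddChar.map_add_eq_mul]
      congr 1
      ring
    simp only [cubicBlock, this]
    rw [← Finset.sum_mul, hψ.sum_mul_apply_eq_ite]
    simp only [mul_eq_zero, hγ, false_or, sub_eq_zero, sq_eq_sq_iff_eq_or_eq_neg]
    split_ifs <;> simp
  let V : Matrix F F ℂ := fun v c =>
    ψ (-(η * v)) * ((if v = c then 1 else 0) + σ c * (if v = -c then 1 else 0))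
  let W : Matrix F F ℂ := fun c v =>
    ψ (η * v) * ((if c = v then 1 else 0) - σ v * (if c = -v then 1 else 0) +
      (if c = 0 then if v = 0 then 1 else 0 else 0))
  have hswap : ∀ w c : F, w = -c ↔ c = -w := fun w c => by
    constructor <;> (intro h; rw [h, neg_neg])
  have hVW : V * W = (2 : ℂ) • (1 : Matrix F F ℂ) := by
    ext w v
    rw [Matrix.mul_apply, Matrix.smul_apply, Matrix.one_apply]
    have : ∀ c, V w c * W c v = (if w = c then ψ (-(η * w)) * W c v else 0) +
        (if c = -w then ψ (-(η * w)) * σ c * W c v else 0) := by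
      intro c
      simp only [V, hswap w c]
      split_ifs <;> ring
    simp only [this, Finset.sum_add_distrib, Finset.sum_ite_eq, Finset.sum_ite_eq',
      Finset.mem_univ, if_true]
    have e : ψ (-(η * w)) * ψ (η * w) = 1 := by
      rw [← AddChar.map_add_eq_mul]
      simp
    by_cases hw : w = 0
    · subst hw
      by_cases hv : v = 0
      · subst hv
        norm_num [W, h0]
      · have hv' : (0 : F) ≠ v := fun h => hv h.symm
        simp [W, h0, hv, hv']
    · have hw1 : w ≠ -w := fun h => hw ((hneg w).1 h)
      have hw2 : -w ≠ w := fun h => hw1 h.symm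
      by_cases hwv : w = v
      · subst hwv
        rcases hsign w hw with h | h
        · simp only [W, hw, hw1, hw2, hodd, h, neg_eq_zero, if_true, if_false]
          push_cast
          simp only [smul_eq_mul]
          linear_combination (2 : ℂ) * e
        · simp only [W, hw, hw1, hw2, hodd, h, neg_eq_zero, if_true, if_false]
          push_cast
          simp only [smul_eq_mul]
          linear_combination (2 : ℂ) * e
      · by_cases hwv' : w = -v
        · have hv : v = -w := by rw [hwv', neg_neg]
          subst hv
          simp only [W, hw, hw1, hw2, hodd, neg_eq_zero, neg_neg, if_true, if_false]
          push_cast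
          simp only [smul_eq_mul]
          ring
        · have h3 : ¬ -w = v := fun h => hwv' (by rw [← h, neg_neg])
          simp [W, hw, hwv, hwv', h3]
  have hMV : cubicBlock ψ γ 0 η * V =
      V * Matrix.diagonal fun c => (Fintype.card F : ℂ) * (1 + σ c) := by
    ext w c
    rw [Matrix.mul_diagonal, Matrix.mul_apply]
    have : ∀ v, cubicBlock ψ γ 0 η w v * V v c =
        (if v = c then cubicBlock ψ γ 0 η w v * ψ (-(η * v)) else 0) +
        (if v = -c then cubicBlock ψ γ 0 η w v * ψ (-(η * v)) * σ c else 0) := by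
      intro v
      simp only [V]
      split_ifs <;> ring
    simp only [this, Finset.sum_add_distrib, Finset.sum_ite_eq', Finset.mem_univ, if_true]
    have e : ∀ v, ψ (η * (v - w)) * ψ (-(η * v)) = ψ (-(η * w)) := by
      intro v
      rw [← AddChar.map_add_eq_mul]
      congr 1
      ring
    have hMe : ∀ v, cubicBlock ψ γ 0 η w v * ψ (-(η * v)) =
        if v = w ∨ v = -w then (Fintype.card F : ℂ) * ψ (-(η * w)) else 0 := by
      intro v
      rw [hM, ite_mul, zero_mul, mul_assoc, e]
    simp only [hMe, V]
    by_cases hwc : w = c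
    · subst hwc
      by_cases hw : w = 0
      · subst hw
        simp [h0]
      · have hw1 : w ≠ -w := fun h => hw ((hneg w).1 h)
        simp only [hw1, true_or, or_true, if_true, if_false]
        ring
    · by_cases hwc' : w = -c
      · have hc : c = -w := by rw [hwc', neg_neg]
        subst hc
        have hw : w ≠ 0 := by
          rintro rfl
          simp at hwc
        simp only [neg_neg, hwc, true_or, or_true, if_true, if_false, hodd]
        push_cast
        rcases hsign w hw with h | h <;> rw [h] <;> push_cast <;> ring
      · have h1 : ¬ c = w := fun h => hwc h.symm
        have h2 : ¬ c = -w := fun h => hwc' ((hswap w c).2 h)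
        have h3 : ¬ -c = w := fun h => hwc' h.symm
        simp [h1, h2, h3, hwc, hwc']
  rw [charpoly_sub_smul_of_mul_eq_mul two_ne_zero hVW hMV]
  have hX : ∀ u, (X - C ((Fintype.card F : ℂ) * (1 + σ u) - Fintype.card F) : ℂ[X]) =
      (fun n : ℤ => X - C ((Fintype.card F : ℂ) * n)) (σ u) := by
    intro u
    simp only
    congr 2
    ring
  simp only [hX]
  rw [prod_comp_of_sum_eq_zero h0 hsign hsum
    (fun n : ℤ => (X - C ((Fintype.card F : ℂ) * n) : ℂ[X]))]
  simp

/-- The exponential sum of a cubic polynomial without constant and quadratic term. -/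
noncomputable def cubicSum (ψ : AddChar F ℂ) (a c : F) : ℂ := ∑ t, ψ (a * t ^ 3 + c * t)

omit [DecidableEq F] in
theorem cubicSum_neg (ψ : AddChar F ℂ) (a c : F) : cubicSum ψ (-a) (-c) = cubicSum ψ a c := by
  unfold cubicSum
  rw [← Equiv.sum_comp (Equiv.neg F)]
  refine Finset.sum_congr rfl fun t _ => ?_
  simp only [Equiv.neg_apply]
  congr 1
  ring

/-- With `a = γ²/(3δ)` and `r = δt/γ` one has
`γ(v² - w²)t + δ(v - w)t² = a((v + r)³ - (w + r)³) - a(v³ - w³)`. Hence, after conjugation by the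
diagonal matrix with entries `ψ(av³ - ηv)`, the block is a convolution matrix, and the characters
`v ↦ ψ(cv)` are its eigenvectors. -/
theorem charpoly_cubicBlock {ψ : AddChar F ℂ} (hψ : ψ.IsPrimitive) (h3 : (3 : F) ≠ 0) {γ δ : F}
    (hγ : γ ≠ 0) (hδ : δ ≠ 0) (η : F) :
    (cubicBlock ψ γ δ η - (Fintype.card F : ℂ) • (1 : Matrix F F ℂ)).charpoly =
      ∏ c, (X - C (cubicSum ψ (γ ^ 2 / (3 * δ)) c ^ 2 - Fintype.card F)) := by
  have hq : (Fintype.card F : ℂ) ≠ 0 := Nat.cast_ne_zero.2 Fintype.card_ne_zero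
  set a := γ ^ 2 / (3 * δ) with ha
  have haγ : 3 * a * (δ / γ) = γ := by
    rw [ha]
    field_simp
  have haδ : 3 * a * (δ / γ) ^ 2 = δ := by
    rw [ha]
    field_simp
  let V : Matrix F F ℂ := fun v c => ψ (a * v ^ 3 - η * v + c * v)
  let W : Matrix F F ℂ := fun c v => ψ (-(a * v ^ 3 - η * v + c * v))
  have hVW : V * W = (Fintype.card F : ℂ) • (1 : Matrix F F ℂ) := by
    ext w v
    rw [Matrix.mul_apply, Matrix.smul_apply, Matrix.one_apply]
    have : ∀ c, V w c * W c v =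
        ψ (a * w ^ 3 - η * w - (a * v ^ 3 - η * v)) * ψ (c * (w - v)) := by
      intro c
      simp only [V, W, ← AddChar.map_add_eq_mul]
      congr 1
      ring
    simp only [this, ← Finset.mul_sum, hψ.sum_mul_apply_eq_ite, sub_eq_zero]
    split_ifs with h
    · simp [h]
    · simp
  refine charpoly_sub_smul_of_mul_eq_mul hq hVW ?_ _
  ext w c
  rw [Matrix.mul_diagonal, Matrix.mul_apply]
  have hM : ∀ v, cubicBlock ψ γ δ η w v * V v c =
      ∑ r, ψ (a * w ^ 3 - η * w + c * w - (a * (w + r) ^ 3 + c * (w + r))) *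
        ψ (a * (v + r) ^ 3 + c * (v + r)) := by
    intro v
    simp only [cubicBlock, V, Finset.sum_mul]
    symm
    rw [← Equiv.sum_comp (Equiv.mulLeft₀ (δ / γ) (div_ne_zero hδ hγ))]
    refine Finset.sum_congr rfl fun t _ => ?_
    simp only [← AddChar.map_add_eq_mul, Equiv.mulLeft₀_apply]
    congr 1
    linear_combination (v ^ 2 - w ^ 2) * t * haγ + (v - w) * t ^ 2 * haδ
  have hshift : ∀ (b d u : F), ∑ v, ψ (b * (v + u) ^ 3 + d * (v + u)) = cubicSum ψ b d :=
    fun b d u => Equiv.sum_comp (Equiv.addRight u) fun t => ψ (b * t ^ 3 + d * t)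
  simp only [hM]
  rw [Finset.sum_comm]
  simp only [← Finset.mul_sum, hshift]
  rw [← Finset.sum_mul, sq, ← mul_assoc]
  congr 1
  rw [← cubicSum_neg ψ a c, ← hshift (-a) (-c) w, Finset.mul_sum]
  refine Finset.sum_congr rfl fun r _ => ?_
  simp only [V, ← AddChar.map_add_eq_mul]
  congr 1
  ring

end Blocks

/-! ### Factorization over the frequencies -/

section Factorization

variable {F : Type*} [Field F] [Fintype F] [DecidableEq F]

theorem card_roots_quadratic (hF : ringChar F ≠ 2) {δ : F} (hδ : δ ≠ 0) (u η : F) :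
    ((Finset.univ.filter fun t => δ * t ^ 2 + u * t + η = 0).card : ℤ) =
      quadraticChar F (u ^ 2 - 4 * δ * η) + 1 := by
  have h2 : (2 : F) ≠ 0 := Ring.two_ne_zero hF
  have h2δ : 2 * δ ≠ 0 := mul_ne_zero h2 hδ
  rw [← quadraticChar_card_sqrts hF]
  congr 1
  refine Finset.card_equiv ((Equiv.mulLeft₀ (2 * δ) h2δ).trans (Equiv.addRight u)) fun t => ?_
  simp only [Finset.mem_filter, Finset.mem_univ, true_and, Set.mem_toFinset, Set.mem_ofPred_eq,
    Equiv.trans_apply, Equiv.mulLeft₀_apply, Equiv.coe_addRight]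
  have key : (2 * δ * t + u) ^ 2 - (u ^ 2 - 4 * δ * η) = 2 * (2 * δ) * (δ * t ^ 2 + u * t + η) := by
    ring
  rw [← sub_eq_zero (a := (2 * δ * t + u) ^ 2), key, mul_eq_zero,
    or_iff_right (mul_ne_zero h2 h2δ)]

/-- For fixed `δ ≠ 0` and `u` the discriminant `u² - 4δη` runs through the field with `η`. -/
theorem prod_card_roots_quadratic (hF : ringChar F ≠ 2) {δ : F} (hδ : δ ≠ 0) (u : F) (q : ℂ) :
    ∏ η, (X - C (q *
      ((Finset.univ.filter fun t => δ * t ^ 2 + u * t + η = 0).card - 1)) : ℂ[X]) =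
      X * ((X - C q) * (X + C q)) ^ ((Fintype.card F - 1) / 2) := by
  have h4δ : -(2 * 2 * δ) ≠ 0 :=
    neg_ne_zero.2 (mul_ne_zero (mul_ne_zero (Ring.two_ne_zero hF) (Ring.two_ne_zero hF)) hδ)
  have h := prod_comp_of_sum_eq_zero (quadraticChar_zero (F := F))
    (fun u hu => quadraticChar_dichotomy hu) (quadraticChar_sum_zero hF)
    (fun n : ℤ => (X - C (q * n) : ℂ[X]))
  simp only [Int.cast_zero, mul_zero, map_zero, sub_zero, Int.cast_one, mul_one, Int.cast_neg,
    mul_neg, map_neg, sub_neg_eq_add] at h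
  rw [← h]
  symm
  rw [← Equiv.prod_comp ((Equiv.mulLeft₀ _ h4δ).trans (Equiv.addRight (u ^ 2)))]
  refine Finset.prod_congr rfl fun η _ => ?_
  have hc := congrArg (Int.cast : ℤ → ℂ) (card_roots_quadratic hF hδ u η)
  push_cast at hc
  rw [hc, add_sub_cancel_right]
  congr 5
  simp only [Equiv.trans_apply, Equiv.mulLeft₀_apply, Equiv.coe_addRight]
  ring

/-- The contribution of the one-dimensional representations, that is, of the `p₃`-frequency `0`. -/
theorem prod_charpoly_gammaBlock_zero (hF : ringChar F ≠ 2) {ψ : AddChar F ℂ}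
    (hψ : ψ.IsPrimitive) :
    ∏ δ, ∏ η, (gammaBlock ψ (0, δ, η) - (Fintype.card F : ℂ) • (1 : Matrix F F ℂ)).charpoly =
      X ^ (2 * Fintype.card F * (Fintype.card F - 1)) *
      (X - C ((Fintype.card F : ℂ) * ((Fintype.card F : ℂ) - 1))) *
      (X + C (Fintype.card F : ℂ)) ^ (Fintype.card F - 1) *
      ((X - C (Fintype.card F : ℂ)) * (X + C (Fintype.card F : ℂ))) ^
        ((Fintype.card F - 1) / 2 * (Fintype.card F * (Fintype.card F - 1))) := by
  simp only [charpoly_gammaBlock_zero hψ]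
  set q := Fintype.card F with hq
  have hcard : Fintype.card Fˣ = q - 1 := Fintype.card_units F
  rw [Fintype.prod_eq_mul_prod_units]
  have h0 : ∏ η : F, ∏ u : F, (X - C ((q : ℂ) *
      ((Finset.univ.filter fun t : F => 0 * t ^ 2 + u * t + η = 0).card - 1)) : ℂ[X]) =
      (X - C ((q : ℂ) * (q - 1))) * (X + C (q : ℂ)) ^ (q - 1) * X ^ (q * (q - 1)) := by
    rw [Finset.prod_comm, Fintype.prod_eq_mul_prod_units]
    congr 1
    · rw [Fintype.prod_eq_mul_prod_units]
      simp [hcard, Finset.card_univ, ← hq]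
    · have : ∀ (u : Fˣ) (η : F),
          (Finset.univ.filter fun t : F => 0 * t ^ 2 + (u : F) * t + η = 0).card = 1 := by
        intro u η
        rw [Finset.card_eq_one]
        refine ⟨-η / u, ?_⟩
        ext t
        simp only [Finset.mem_filter, Finset.mem_univ, true_and, Finset.mem_singleton, zero_mul,
          zero_add]
        rw [eq_div_iff u.ne_zero, ← add_eq_zero_iff_eq_neg, mul_comm t]
      simp only [this, Nat.cast_one, sub_self, mul_zero, map_zero, sub_zero, Finset.prod_const,
        Finset.card_univ, hcard, ← hq, ← pow_mul]
  have h1 : ∀ δ : Fˣ, ∏ η : F, ∏ u : F, (X - C ((q : ℂ) *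
      ((Finset.univ.filter fun t : F => (δ : F) * t ^ 2 + u * t + η = 0).card - 1)) : ℂ[X]) =
      (X * ((X - C (q : ℂ)) * (X + C (q : ℂ))) ^ ((q - 1) / 2)) ^ q := by
    intro δ
    rw [Finset.prod_comm]
    simp only [prod_card_roots_quadratic hF δ.ne_zero, Finset.prod_const, Finset.card_univ, ← hq]
  rw [h0, Finset.prod_congr rfl fun δ _ => h1 δ, Finset.prod_const, Finset.card_univ, hcard]
  simp only [mul_pow (M := ℂ[X]) X, ← pow_mul]
  ring

/-- The frequencies with `γ = 0` or `δ = 0` have only the eigenvalues `0`, `q(q-1)`, `q` and `-q`.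
-/
theorem phiGamma4_eq (hF : ringChar F ≠ 2) {ψ : AddChar F ℂ} (hψ : ψ.IsPrimitive) :
    phiGamma4 F = X ^ (3 * Fintype.card F * (Fintype.card F - 1)) *
      (X - C ((Fintype.card F : ℂ) * ((Fintype.card F : ℂ) - 1))) *
      (X - C (Fintype.card F : ℂ)) ^ (Fintype.card F * (Fintype.card F - 1) ^ 2) *
      (X + C (Fintype.card F : ℂ)) ^
        (Fintype.card F - 1 + Fintype.card F * (Fintype.card F - 1) ^ 2) *
      ∏ γ : Fˣ, ∏ δ : Fˣ, ∏ η : F,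
        (cubicBlock ψ γ δ η - (Fintype.card F : ℂ) • (1 : Matrix F F ℂ)).charpoly := by
  rw [phiGamma4_eq_prod_charpoly hψ]
  simp only [Fintype.prod_prod_type]
  rw [Fintype.prod_eq_mul_prod_units, prod_charpoly_gammaBlock_zero hF hψ]
  have h1 : ∀ γ : Fˣ, ∏ δ : F, ∏ η : F,
      (gammaBlock ψ (γ, δ, η) - (Fintype.card F : ℂ) • (1 : Matrix F F ℂ)).charpoly =
      (X * ((X - C (Fintype.card F : ℂ)) * (X + C (Fintype.card F : ℂ))) ^
        ((Fintype.card F - 1) / 2)) ^ Fintype.card F * ∏ δ : Fˣ, ∏ η : F,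
        (cubicBlock ψ γ δ η - (Fintype.card F : ℂ) • (1 : Matrix F F ℂ)).charpoly := by
    intro γ
    simp only [charpoly_gammaBlock_of_ne_zero hF ψ γ.ne_zero]
    rw [Fintype.prod_eq_mul_prod_units]
    simp only [charpoly_cubicBlock_zero hF hψ γ.ne_zero, Finset.prod_const, Finset.card_univ]
  rw [Finset.prod_congr rfl fun γ _ => h1 γ, Finset.prod_mul_distrib, Finset.prod_const,
    Finset.card_univ, Fintype.card_units]
  have hodd := FiniteField.odd_card_of_char_ne_two hF
  obtain ⟨h, hh⟩ : ∃ h, Fintype.card F = 2 * h + 1 := ⟨Fintype.card F / 2, by omega⟩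
  have e1 : Fintype.card F - 1 = 2 * h := by omega
  have e2 : (Fintype.card F - 1) / 2 = h := by omega
  have e3 : 2 * h / 2 = h := by omega
  simp only [e1, e3]
  generalize ∏ γ : Fˣ, ∏ δ : Fˣ, ∏ η : F,
        (cubicBlock ψ γ δ η - (Fintype.card F : ℂ) • (1 : Matrix F F ℂ)).charpoly = R
  generalize (X - C (Fintype.card F : ℂ) : ℂ[X]) = a
  generalize (X + C (Fintype.card F : ℂ) : ℂ[X]) = b
  generalize (X - C ((Fintype.card F : ℂ) * ((Fintype.card F : ℂ) - 1)) : ℂ[X]) = c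
  simp only [mul_pow, ← pow_mul]
  ring

/-- The substitution `a = γ²/(3δ)` removes the frequencies from the product. -/
theorem prod_charpoly_cubicBlock {ψ : AddChar F ℂ} (hψ : ψ.IsPrimitive) (h3 : (3 : F) ≠ 0) :
    ∏ γ : Fˣ, ∏ δ : Fˣ, ∏ η : F,
      (cubicBlock ψ γ δ η - (Fintype.card F : ℂ) • (1 : Matrix F F ℂ)).charpoly =
    (∏ a : Fˣ, ∏ c : F, (X + C (Fintype.card F : ℂ) - C (cubicSum ψ a c ^ 2))) ^
      (Fintype.card F * (Fintype.card F - 1)) := by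
  let G : Fˣ → ℂ[X] := fun a => ∏ c : F, (X + C (Fintype.card F : ℂ) - C (cubicSum ψ a c ^ 2))
  let three : Fˣ := Units.mk0 3 h3
  have h1 : ∀ (γ δ : Fˣ) (η : F),
      (cubicBlock ψ γ δ η - (Fintype.card F : ℂ) • (1 : Matrix F F ℂ)).charpoly =
        G (γ ^ 2 / (three * δ)) := by
    intro γ δ η
    rw [charpoly_cubicBlock hψ h3 γ.ne_zero δ.ne_zero]
    refine Finset.prod_congr rfl fun c _ => ?_
    have : ((γ ^ 2 / (three * δ) : Fˣ) : F) = (γ : F) ^ 2 / (3 * δ) := by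
      simp [three]
    rw [this, map_sub]
    ring
  have h2 : ∀ γ : Fˣ, ∏ δ : Fˣ, G (γ ^ 2 / (three * δ)) = ∏ a, G a := fun γ =>
    Fintype.prod_equiv ((Equiv.mulLeft three).trans (Equiv.divLeft (γ ^ 2))) _ _ fun δ => rfl
  simp only [h1, Finset.prod_const, Finset.card_univ, Finset.prod_pow, h2, Fintype.card_units,
    ← pow_mul]
  rw [mul_comm]

end Factorization

/-! ### Linear relations between roots of unity and power sums -/

section PowerSums

variable {p : ℕ} [Fact p.Prime]

/-- A linear relation with integer coefficients between the `p`-th roots of unity has constant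
coefficients; since `∑ xᵏ = 0` over `𝔽_p` for `k < p - 1`, all power sums of such an order vanish
on the exponents of the relation. -/
theorem sum_mul_pow_eq_zero_of_sum_mul_root_pow_eq_zero {ζ : ℂ} (hζ : IsPrimitiveRoot ζ p)
    {ι : Type*} [Fintype ι] (w : ι → ℤ) (v : ι → ZMod p)
    (h : ∑ i, (w i : ℂ) * ζ ^ (v i).val = 0) {k : ℕ} (hk : k < p - 1) :
    ∑ i, (w i : ZMod p) * v i ^ k = 0 := by
  have hp : p.Prime := Fact.out
  let P : ℤ[X] := ∑ i, C (w i) * X ^ (v i).val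
  have hP : aeval ζ P = 0 := by
    simp only [P, map_sum, map_mul, aeval_C, map_pow, aeval_X]
    simpa using h
  have hdvd : cyclotomic p ℤ ∣ P := by
    rw [cyclotomic_eq_minpoly hζ hp.pos]
    exact minpoly.isIntegrallyClosed_dvd (hζ.isIntegral hp.pos) hP
  obtain ⟨R, hR⟩ := hdvd
  have hdegP : P.degree < p := by
    refine mem_degreeLT.1 (Submodule.sum_mem _ fun i _ => mem_degreeLT.2 ?_)
    exact (degree_C_mul_X_pow_le _ _).trans_lt (by exact_mod_cast ZMod.val_lt (v i))
  have hdegR : R.degree ≤ 0 := by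
    rcases eq_or_ne R 0 with rfl | hR0
    · simp
    · rw [hR, degree_mul, degree_cyclotomic, Nat.totient_prime hp,
        degree_eq_natDegree hR0] at hdegP
      rw [degree_eq_natDegree hR0]
      norm_cast at hdegP ⊢
      have := hp.two_le
      omega
  rw [eq_C_of_degree_le_zero hdegR] at hR
  have hcoeff : ∀ a : ZMod p, ∑ i, (if v i = a then w i else 0) = R.coeff 0 := by
    intro a
    have h1 := congrArg (fun Q => Q.coeff a.val) hR
    simp only [P, finsetSum_coeff, coeff_C_mul, coeff_X_pow, coeff_mul_C] at h1
    rw [cyclotomic_prime, finsetSum_coeff] at h1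
    simp only [coeff_X_pow, Finset.sum_ite_eq, Finset.mem_range, ZMod.val_lt, if_true, one_mul]
      at h1
    rw [← h1]
    refine Finset.sum_congr rfl fun i _ => ?_
    simp only [(ZMod.val_injective p).eq_iff, eq_comm (a := a), mul_ite, mul_one, mul_zero]
  have hsum : ∑ i, (w i : ZMod p) * v i ^ k = ∑ a : ZMod p, ((R.coeff 0 : ℤ) : ZMod p) * a ^ k := by
    have hcast : ∀ a : ZMod p, ((R.coeff 0 : ℤ) : ZMod p) * a ^ k =
        ∑ i, if v i = a then (w i : ZMod p) * a ^ k else 0 := by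
      intro a
      rw [← hcoeff a, Int.cast_sum, Finset.sum_mul]
      refine Finset.sum_congr rfl fun i _ => ?_
      split_ifs <;> simp
    simp only [hcast]
    rw [Finset.sum_comm]
    simp
  rw [hsum, ← Finset.mul_sum, FiniteField.sum_pow_lt_card_sub_one, mul_zero]
  rwa [ZMod.card]

/-- The square of `ε_f` determines the power sums of `f` of order less than `p - 1` up to a common
sign. -/
theorem pow_sum_eq_or_eq_neg_of_expSum_sq_eq {ζ : ℂ} (hζ : IsPrimitiveRoot ζ p)
    {f g : ZMod p → ZMod p} (h : expSum ζ f ^ 2 = expSum ζ g ^ 2) :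
    (∀ k < p - 1, ∑ t, f t ^ k = ∑ t, g t ^ k) ∨ (∀ k < p - 1, ∑ t, f t ^ k = -∑ t, g t ^ k) := by
  rcases sq_eq_sq_iff_eq_or_eq_neg.1 h with h | h
  · refine Or.inl fun k hk => ?_
    have := sum_mul_pow_eq_zero_of_sum_mul_root_pow_eq_zero hζ (ι := ZMod p ⊕ ZMod p)
      (Sum.elim (fun _ => 1) (fun _ => -1)) (Sum.elim f g) (by
        simp only [Fintype.sum_sum_type, Sum.elim_inl, Sum.elim_inr, Int.cast_one, one_mul,
          Int.cast_neg, neg_mul, Finset.sum_neg_distrib]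
        exact add_neg_eq_zero.2 h) hk
    simp only [Fintype.sum_sum_type, Sum.elim_inl, Sum.elim_inr, Int.cast_one, one_mul,
      Int.cast_neg, neg_mul, Finset.sum_neg_distrib] at this
    exact add_neg_eq_zero.1 this
  · refine Or.inr fun k hk => ?_
    have := sum_mul_pow_eq_zero_of_sum_mul_root_pow_eq_zero hζ (ι := ZMod p ⊕ ZMod p)
      (fun _ => 1) (Sum.elim f g) (by
        simp only [Fintype.sum_sum_type, Sum.elim_inl, Sum.elim_inr, Int.cast_one, one_mul]
        exact eq_neg_iff_add_eq_zero.1 h) hk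
    simp only [Fintype.sum_sum_type, Sum.elim_inl, Sum.elim_inr, Int.cast_one, one_mul] at this
    exact eq_neg_iff_add_eq_zero.2 this

theorem ZMod.natCast_choose_ne_zero {n k : ℕ} (hn : n < p) (hk : k ≤ n) :
    (n.choose k : ZMod p) ≠ 0 := by
  have hp : p.Prime := Fact.out
  rw [Ne, ZMod.natCast_eq_zero_iff]
  intro h
  have h1 : p ∣ n.factorial := by
    rw [← Nat.choose_mul_factorial_mul_factorial hk, mul_assoc]
    exact h.mul_right _
  have := (hp.dvd_factorial).1 h1
  omega

/-- If `k < (p - 1) / 2` is the order of the first nonvanishing power sum of `f`, then `ε_f` has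
`(1 - ζ)`-adic valuation `k`, so `ε_f²` is not a multiple of `p`. The power sum of order `2k` of
the values of `f(a) + f(b)` detects this. -/
theorem expSum_sq_ne_mul {ζ : ℂ} (hζ : IsPrimitiveRoot ζ p) {f : ZMod p → ZMod p} {k : ℕ}
    (hk : 2 * k < p - 1) (h0 : ∀ r < k, ∑ t, f t ^ r = 0) (hk0 : ∑ t, f t ^ k ≠ 0) (m : ℤ) :
    expSum ζ f ^ 2 ≠ p * m := by
  intro h
  have hrel := sum_mul_pow_eq_zero_of_sum_mul_root_pow_eq_zero hζ (ι := (ZMod p × ZMod p) ⊕ Unit)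
    (Sum.elim (fun _ => 1) (fun _ => -(p * m))) (Sum.elim (fun x => f x.1 + f x.2) (fun _ => 0)) (by
      have hpow : ∀ a b : ZMod p, ζ ^ (a + b).val = ζ ^ a.val * ζ ^ b.val := by
        intro a b
        simp only [← AddChar.zmodChar_apply hζ.pow_eq_one, AddChar.map_add_eq_mul]
      simp only [Fintype.sum_sum_type, Sum.elim_inl, Sum.elim_inr, Int.cast_one, one_mul, hpow,
        Fintype.sum_prod_type, ← Finset.mul_sum, ← Finset.sum_mul]
      rw [expSum] at h
      rw [← sq, h]
      simp) hk
  simp only [Fintype.sum_sum_type, Sum.elim_inl, Sum.elim_inr, Int.cast_one, one_mul,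
    Fintype.sum_prod_type, Int.cast_neg, Int.cast_mul, Int.cast_natCast, CharP.cast_eq_zero,
    zero_mul, neg_zero, Finset.sum_const_zero, add_zero, add_pow] at hrel
  have hswap : ∑ x, ∑ y, ∑ r ∈ Finset.range (2 * k + 1),
      f x ^ r * f y ^ (2 * k - r) * ((2 * k).choose r : ZMod p) =
      ∑ r ∈ Finset.range (2 * k + 1),
        (∑ x, f x ^ r) * (∑ y, f y ^ (2 * k - r)) * ((2 * k).choose r : ZMod p) := by
    rw [Finset.sum_congr rfl fun x _ => Finset.sum_comm, Finset.sum_comm]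
    refine Finset.sum_congr rfl fun r _ => ?_
    rw [Finset.sum_mul_sum, Finset.sum_mul]
    simp only [Finset.sum_mul]
  rw [hswap, Finset.sum_eq_single k] at hrel
  · have e : 2 * k - k = k := by omega
    rw [e] at hrel
    exact mul_ne_zero (mul_ne_zero hk0 hk0)
      (ZMod.natCast_choose_ne_zero (by omega) (by omega)) hrel
  · intro r hr hrk
    rw [Finset.mem_range] at hr
    rcases lt_or_gt_of_ne hrk with h | h
    · rw [h0 r h, zero_mul, zero_mul]
    · rw [h0 (2 * k - r) (by omega), mul_zero, zero_mul]
  · intro h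
    simp at h
    omega

/-! ### Power sums of cubic polynomials -/

theorem ZMod.sum_pow_eq_ite (n : ℕ) :
    ∑ t : ZMod p, t ^ n = if n ≠ 0 ∧ p - 1 ∣ n then -1 else 0 := by
  rcases eq_or_ne n 0 with rfl | hn
  · simp
  · have hu := Fintype.prod_eq_mul_prod_units (fun t : ZMod p => Multiplicative.ofAdd (t ^ n))
    rw [← ofAdd_sum, ← ofAdd_sum, ← ofAdd_add] at hu
    rw [Multiplicative.ofAdd.injective hu, zero_pow hn, zero_add]
    have := FiniteField.sum_pow_units (ZMod p) n
    rw [ZMod.card] at this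
    rw [this]
    simp [hn]

/-- The term `t ^ (3j + (k - j))` of the binomial expansion has exponent `k + 2j`. -/
theorem sum_cubic_pow (a b : ZMod p) (k : ℕ) :
    ∑ t : ZMod p, (a * t ^ 3 + b * t) ^ k =
      ∑ j ∈ Finset.range (k + 1), (k.choose j : ZMod p) * a ^ j * b ^ (k - j) *
        if k + 2 * j ≠ 0 ∧ p - 1 ∣ k + 2 * j then -1 else 0 := by
  simp only [add_pow]
  rw [Finset.sum_comm]
  refine Finset.sum_congr rfl fun j hj => ?_
  have hj' : j ≤ k := Nat.lt_succ_iff.1 (Finset.mem_range.1 hj)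
  rw [← ZMod.sum_pow_eq_ite, Finset.mul_sum]
  refine Finset.sum_congr rfl fun t _ => ?_
  have e : k + 2 * j = 3 * j + (k - j) := by omega
  rw [e, pow_add, mul_pow, mul_pow, ← pow_mul]
  ring

theorem sum_cubic_pow_eq_zero (a b : ZMod p) {k : ℕ} (hk : 3 * k < p - 1) :
    ∑ t : ZMod p, (a * t ^ 3 + b * t) ^ k = 0 := by
  rw [sum_cubic_pow]
  refine Finset.sum_eq_zero fun j hj => ?_
  rw [Finset.mem_range] at hj
  rw [if_neg, mul_zero]
  rintro ⟨h0, h⟩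
  have := Nat.le_of_dvd (Nat.pos_of_ne_zero h0) h
  omega

/-- If `3k < 2(p - 1)`, at most one term of the binomial expansion survives the summation over `t`,
namely the one with exponent `p - 1`. -/
theorem sum_cubic_pow_eq (a b : ZMod p) {k j : ℕ} (hjk : k + 2 * j = p - 1) (hj : j ≤ k)
    (hk : 3 * k < 2 * (p - 1)) :
    ∑ t : ZMod p, (a * t ^ 3 + b * t) ^ k = -((k.choose j : ZMod p) * a ^ j * b ^ (k - j)) := by
  have hp : 0 < p - 1 := by
    have := (Fact.out : p.Prime).two_le
    omega
  rw [sum_cubic_pow, Finset.sum_eq_single j]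
  · rw [if_pos ⟨by omega, by rw [hjk]⟩, mul_neg_one]
  · intro i hi hij
    rw [Finset.mem_range] at hi
    rw [if_neg, mul_zero]
    rintro ⟨h0, c, hc⟩
    have hc1 : c = 1 := by
      rcases c with _ | _ | c
      · omega
      · rfl
      · exfalso
        have : (p - 1) * 2 ≤ (p - 1) * (c + 1 + 1) := Nat.mul_le_mul_left _ (by omega)
        omega
    subst hc1
    omega
  · intro h
    rw [Finset.mem_range] at h
    omega

end PowerSums

/-! ### Distinctness of the exponential sums -/

section Distinct

variable {p : ℕ} [Fact p.Prime]

/-- The first nonvanishing power sum has order `(p + 1) / 3`. This is less than `(p - 1) / 2` only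
for `p > 5`; for `p = 5` two of the squares are equal to `5`. -/
theorem expSum_cubic_sq_ne_mul_of_mod_three_eq_two (h5 : 5 < p) (h3 : p % 3 = 2) {ζ : ℂ}
    (hζ : IsPrimitiveRoot ζ p) {c : ZMod p} (hc : c ≠ 0) (m : ℤ) :
    expSum ζ (fun t => t ^ 3 + c * t) ^ 2 ≠ p * m := by
  have hodd : p % 2 = 1 := ((Fact.out : p.Prime).eq_two_or_odd).resolve_left (by omega)
  obtain ⟨n, hn⟩ : ∃ n, p = 6 * n + 5 := ⟨p / 6, by omega⟩
  have hform : (fun t : ZMod p => t ^ 3 + c * t) = fun t => 1 * t ^ 3 + c * t := by simp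
  rw [hform]
  refine expSum_sq_ne_mul hζ (k := 2 * n + 2) (by omega)
    (fun r hr => sum_cubic_pow_eq_zero 1 c (by omega)) ?_ m
  rw [sum_cubic_pow_eq 1 c (k := 2 * n + 2) (j := 2 * n + 1) (by omega) (by omega) (by omega)]
  exact neg_ne_zero.2 (mul_ne_zero (mul_ne_zero (ZMod.natCast_choose_ne_zero (by omega) (by omega))
    (by simp)) (pow_ne_zero _ hc))

theorem expSum_cubic_sq_injective_of_mod_three_eq_two (h5 : 5 < p) (h3 : p % 3 = 2) {ζ : ℂ}
    (hζ : IsPrimitiveRoot ζ p) {c d : ZMod p} (hc : c ≠ 0)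
    (h : expSum ζ (fun t => t ^ 3 + c * t) ^ 2 = expSum ζ (fun t => t ^ 3 + d * t) ^ 2) :
    c = d := by
  have hodd : p % 2 = 1 := ((Fact.out : p.Prime).eq_two_or_odd).resolve_left (by omega)
  obtain ⟨n, hn⟩ : ∃ n, p = 6 * n + 5 := ⟨p / 6, by omega⟩
  have hform : ∀ c : ZMod p, (fun t : ZMod p => t ^ 3 + c * t) = fun t => 1 * t ^ 3 + c * t := by
    simp
  rw [hform, hform] at h
  have hS : ∀ c : ZMod p, ∑ t : ZMod p, (1 * t ^ 3 + c * t) ^ (2 * n + 2) =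
      -(((2 * n + 2).choose (2 * n + 1) : ZMod p) * c) := by
    intro c
    rw [sum_cubic_pow_eq 1 c (k := 2 * n + 2) (j := 2 * n + 1) (by omega) (by omega) (by omega)]
    have e : 2 * n + 2 - (2 * n + 1) = 1 := by omega
    simp [e]
  have hS' : ∀ c : ZMod p, ∑ t : ZMod p, (1 * t ^ 3 + c * t) ^ (2 * n + 4) =
      -(((2 * n + 4).choose (2 * n) : ZMod p) * c ^ 4) := by
    intro c
    rw [sum_cubic_pow_eq 1 c (k := 2 * n + 4) (j := 2 * n) (by omega) (by omega) (by omega)]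
    have e : 2 * n + 4 - 2 * n = 4 := by omega
    simp [e]
  have hch : ((2 * n + 2).choose (2 * n + 1) : ZMod p) ≠ 0 :=
    ZMod.natCast_choose_ne_zero (by omega) (by omega)
  have hch' : ((2 * n + 4).choose (2 * n) : ZMod p) ≠ 0 :=
    ZMod.natCast_choose_ne_zero (by omega) (by omega)
  rcases pow_sum_eq_or_eq_neg_of_expSum_sq_eq hζ h with h | h
  · have h1 := h (2 * n + 2) (by omega)
    rw [hS, hS, neg_inj, mul_right_inj' hch] at h1
    exact h1
  · -- The power sum of order `(p + 1) / 3` forces `d = -c`; the next one is even in `c`.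
    exfalso
    have h1 := h (2 * n + 2) (by omega)
    rw [hS, hS, neg_inj, ← mul_neg, mul_right_inj' hch] at h1
    have h2 := h (2 * n + 4) (by omega)
    have hd : d = -c := by rw [h1, neg_neg]
    rw [hS', hS', hd, neg_inj, ← mul_neg, mul_right_inj' hch'] at h2
    have h22 : (2 : ZMod p) ≠ 0 := by
      refine Ring.two_ne_zero ?_
      rw [ZMod.ringChar_zmod_n]
      omega
    have h4 : 2 * c ^ 4 = 0 := by linear_combination h2
    exact mul_ne_zero h22 (pow_ne_zero 4 hc) h4

/-- The first nonvanishing power sum has order `(p - 1) / 3`. -/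
theorem expSum_cubic_sq_ne_mul_of_mod_three_eq_one (h3 : p % 3 = 1) {ζ : ℂ}
    (hζ : IsPrimitiveRoot ζ p) {a : ZMod p} (ha : a ≠ 0) (b : ZMod p) (m : ℤ) :
    expSum ζ (fun t => a * t ^ 3 + b * t) ^ 2 ≠ p * m := by
  have hodd : p % 2 = 1 := ((Fact.out : p.Prime).eq_two_or_odd).resolve_left (by omega)
  obtain ⟨n, hn⟩ : ∃ n, p = 6 * n + 1 := ⟨p / 6, by omega⟩
  have hp := (Fact.out : p.Prime).two_le
  refine expSum_sq_ne_mul hζ (k := 2 * n) (by omega)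
    (fun r hr => sum_cubic_pow_eq_zero a b (by omega)) ?_ m
  rw [sum_cubic_pow_eq a b (k := 2 * n) (j := 2 * n) (by omega) (by omega) (by omega)]
  exact neg_ne_zero.2 (mul_ne_zero (mul_ne_zero (ZMod.natCast_choose_ne_zero (by omega) (by omega))
    (pow_ne_zero _ ha)) (by simp))

/-- The power sums of order `(p - 1) / 3` and `(p - 1) / 3 + 2` recover two monomials in the
coefficients from the square of the exponential sum. The sign ambiguity of the square root is
settled by the fact that `α ^ ((p - 1) / 3)` is a cube root of unity, unlike its negative. -/
theorem pow_eq_pow_of_expSum_cubic_sq_eq (h3 : p % 3 = 1) {ζ : ℂ} (hζ : IsPrimitiveRoot ζ p)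
    {a a' b b' : ZMod p} (ha : a ≠ 0) (ha' : a' ≠ 0)
    (h : expSum ζ (fun t => a * t ^ 3 + b * t) ^ 2 =
      expSum ζ (fun t => a' * t ^ 3 + b' * t) ^ 2) :
    a ^ ((p - 1) / 3) = a' ^ ((p - 1) / 3) ∧
      a ^ ((p - 1) / 3 - 1) * b ^ 3 = a' ^ ((p - 1) / 3 - 1) * b' ^ 3 := by
  have hodd : p % 2 = 1 := ((Fact.out : p.Prime).eq_two_or_odd).resolve_left (by omega)
  obtain ⟨n, hn⟩ : ∃ n, p = 6 * n + 1 := ⟨p / 6, by omega⟩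
  have hp := (Fact.out : p.Prime).two_le
  have e1 : (p - 1) / 3 = 2 * n := by omega
  rw [e1]
  have hS : ∀ a b : ZMod p, ∑ t : ZMod p, (a * t ^ 3 + b * t) ^ (2 * n) = -a ^ (2 * n) := by
    intro a b
    rw [sum_cubic_pow_eq a b (k := 2 * n) (j := 2 * n) (by omega) (by omega) (by omega)]
    simp
  have hcube : ∀ a : ZMod p, a ≠ 0 → (a ^ (2 * n)) ^ 3 = 1 := by
    intro a ha
    rw [← pow_mul, ← ZMod.pow_card_sub_one_eq_one ha]
    congr 1
    omega
  have h22 : (2 : ZMod p) ≠ 0 := by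
    refine Ring.two_ne_zero ?_
    rw [ZMod.ringChar_zmod_n]
    omega
  have hpos : ∀ k < p - 1, ∑ t : ZMod p, (a * t ^ 3 + b * t) ^ k =
      ∑ t : ZMod p, (a' * t ^ 3 + b' * t) ^ k := by
    refine (pow_sum_eq_or_eq_neg_of_expSum_sq_eq hζ h).resolve_right fun hneg => ?_
    have h1 := hneg (2 * n) (by omega)
    rw [hS, hS, neg_inj] at h1
    have h2 := hcube a ha
    rw [h1, neg_pow, hcube a' ha'] at h2
    refine h22 ?_
    linear_combination -h2
  have h1 : a ^ (2 * n) = a' ^ (2 * n) := by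
    have h1 := hpos (2 * n) (by omega)
    rwa [hS, hS, neg_inj] at h1
  refine ⟨h1, ?_⟩
  have h2 := hpos (2 * n + 2) (by omega)
  have hch : ((2 * n + 2).choose (2 * n - 1) : ZMod p) ≠ 0 :=
    ZMod.natCast_choose_ne_zero (by omega) (by omega)
  by_cases hn1 : n = 1
  · -- For `p = 7` the power sum of order `4` has two terms, `4ab³` and `a⁴`.
    subst hn1
    subst hn
    have hS' : ∀ a b : ZMod (6 * 1 + 1), 
        ∑ t : ZMod (6 * 1 + 1), (a * t ^ 3 + b * t) ^ (2 * 1 + 2) =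
          -(4 * a * b ^ 3 + a ^ 4) := by
      intro a b
      rw [sum_cubic_pow]
      simp [Finset.sum_range_succ, Nat.choose]
      ring
    have h4 : a ^ 4 = a' ^ 4 := by linear_combination (a ^ 2 + a' ^ 2) * h1
    have h7 : (7 : ZMod (6 * 1 + 1)) = 0 := rfl
    rw [hS', hS'] at h2
    simp only [mul_one, Nat.add_one_sub_one, pow_one]
    linear_combination (-2) * h2 - 2 * h4 - (a * b ^ 3 - a' * b' ^ 3) * h7
  · have hS' : ∀ a b : ZMod p, ∑ t : ZMod p, (a * t ^ 3 + b * t) ^ (2 * n + 2) =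
        -(((2 * n + 2).choose (2 * n - 1) : ZMod p) * (a ^ (2 * n - 1) * b ^ 3)) := by
      intro a b
      rw [sum_cubic_pow_eq a b (k := 2 * n + 2) (j := 2 * n - 1) (by omega) (by omega) (by omega)]
      have e : 2 * n + 2 - (2 * n - 1) = 3 := by omega
      rw [e, mul_assoc]
    rw [hS', hS', neg_inj, mul_right_inj' hch] at h2
    exact h2

end Distinct

/-! ### Roots of split polynomials -/

section Roots

variable {ι K : Type*} [Fintype ι] [DecidableEq ι] [Field K]

theorem rootMultiplicity_prod_X_sub_C_pow {r : ι → K} (hr : Function.Injective r) (n : ι → ℕ)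
    (i : ι) : (∏ j, (X - C (r j)) ^ n j).rootMultiplicity (r i) = n i := by
  have hne : ∏ j ∈ Finset.univ.erase i, (X - C (r j)) ^ n j ≠ 0 :=
    Finset.prod_ne_zero_iff.2 fun j _ => pow_ne_zero _ (X_sub_C_ne_zero _)
  rw [← Finset.mul_prod_erase _ _ (Finset.mem_univ i), mul_comm,
    rootMultiplicity_mul_X_sub_C_pow hne, rootMultiplicity_eq_zero, zero_add]
  rw [IsRoot, eval_prod, Finset.prod_eq_zero_iff]
  rintro ⟨j, hj, h⟩
  rw [eval_pow, eval_sub, eval_X, eval_C] at h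
  exact (Finset.mem_erase.1 hj).1 (hr (sub_eq_zero.1 (eq_zero_of_pow_eq_zero h))).symm

omit [DecidableEq ι] in
theorem card_roots_toFinset_prod_X_sub_C_pow [DecidableEq K] {r : ι → K}
    (hr : Function.Injective r) {n : ι → ℕ} (hn : ∀ i, n i ≠ 0) :
    (∏ j, (X - C (r j)) ^ n j).roots.toFinset.card = Fintype.card ι := by
  have hne : ∏ j, (X - C (r j)) ^ n j ≠ 0 :=
    Finset.prod_ne_zero_iff.2 fun j _ => pow_ne_zero _ (X_sub_C_ne_zero _)
  have : (∏ j, (X - C (r j)) ^ n j).roots.toFinset = Finset.univ.image r := by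
    ext x
    rw [Multiset.mem_toFinset, mem_roots hne, IsRoot, eval_prod, Finset.prod_eq_zero_iff,
      Finset.mem_image]
    simp only [Finset.mem_univ, true_and, eval_pow, eval_sub, eval_X, eval_C,
      pow_eq_zero_iff (hn _), sub_eq_zero, eq_comm]
  rw [this, Finset.card_image_of_injective _ hr, Finset.card_univ]

end Roots

/-! ### The characteristic polynomial over prime fields -/

section Prime

variable {p : ℕ} [Fact p.Prime]

theorem ZMod.ringChar_ne_two_of_odd (hodd : Odd p) : ringChar (ZMod p) ≠ 2 := by
  rw [ZMod.ringChar_zmod_n]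
  rintro rfl
  exact absurd hodd (by decide)

theorem phiGamma4_zmod_eq (hodd : Odd p) {ψ : AddChar (ZMod p) ℂ} (hψ : ψ.IsPrimitive) :
    phiGamma4 (ZMod p) = X ^ (3 * p * (p - 1)) * (X - C ((p : ℂ) * ((p : ℂ) - 1))) *
      (X - C (p : ℂ)) ^ (p * (p - 1) ^ 2) * (X + C (p : ℂ)) ^ (p - 1 + p * (p - 1) ^ 2) *
      ∏ γ : (ZMod p)ˣ, ∏ δ : (ZMod p)ˣ, ∏ η : ZMod p,
        (cubicBlock ψ γ δ η - (p : ℂ) • (1 : Matrix (ZMod p) (ZMod p) ℂ)).charpoly := by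
  have h := phiGamma4_eq (ZMod.ringChar_ne_two_of_odd hodd) hψ
  rwa [ZMod.card] at h

theorem phiGamma4_zmod_eq_of_ne_three (hodd : Odd p) (h3 : p ≠ 3) {ζ : ℂ}
    (hζ : IsPrimitiveRoot ζ p) :
    phiGamma4 (ZMod p) = X ^ (3 * p * (p - 1)) * (X - C ((p : ℂ) * ((p : ℂ) - 1))) *
      (X - C (p : ℂ)) ^ (p * (p - 1) ^ 2) * (X + C (p : ℂ)) ^ (p - 1 + p * (p - 1) ^ 2) *
      (∏ a : (ZMod p)ˣ, ∏ c : ZMod p,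
        (X + C (p : ℂ) - C (expSum ζ (fun t => (a : ZMod p) * t ^ 3 + c * t) ^ 2))) ^
          (p * (p - 1)) := by
  have h3' : (3 : ZMod p) ≠ 0 := by
    intro h
    have h' : ((3 : ℕ) : ZMod p) = 0 := by exact_mod_cast h
    rw [ZMod.natCast_eq_zero_iff] at h'
    exact h3 ((Nat.prime_dvd_prime_iff_eq Fact.out Nat.prime_three).1 h')
  have hψ := AddChar.zmodChar_primitive_of_primitive_root p hζ
  have h := prod_charpoly_cubicBlock hψ h3'
  rw [ZMod.card] at h
  rw [phiGamma4_zmod_eq hodd hψ, h]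
  rfl

theorem expSum_comp_equiv (ζ : ℂ) (f : ZMod p → ZMod p) (e : ZMod p ≃ ZMod p) :
    expSum ζ (fun t => f (e t)) = expSum ζ f :=
  Equiv.sum_comp e fun t => ζ ^ (f t).val

/-- The substitution `t ↦ bt` changes the leading coefficient by a cube. -/
theorem expSum_mul_cube (ζ : ℂ) (a b : (ZMod p)ˣ) (c : ZMod p) :
    expSum ζ (fun t => ((a * b ^ 3 : (ZMod p)ˣ) : ZMod p) * t ^ 3 + c * t) =
      expSum ζ (fun t => (a : ZMod p) * t ^ 3 + c * ((b⁻¹ : (ZMod p)ˣ) : ZMod p) * t) := by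
  rw [← expSum_comp_equiv ζ (fun t => (a : ZMod p) * t ^ 3 + c * ((b⁻¹ : (ZMod p)ˣ) : ZMod p) * t)
    (Units.mulLeft b)]
  congr 1
  funext t
  have hb : ((b⁻¹ : (ZMod p)ˣ) : ZMod p) * b = 1 := Units.inv_mul b
  rw [Units.mulLeft_apply]
  rw [Units.val_mul, Units.val_pow_eq_pow_val]
  linear_combination (-(c * t)) * hb

/-- If `3 ∤ p - 1`, every unit is a cube, and the leading coefficient can be normalized to `1`. -/
theorem prod_expSum_of_mod_three_eq_two (h3 : p % 3 = 2) (ζ : ℂ) (g : ℂ → ℂ[X]) :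
    ∏ a : (ZMod p)ˣ, ∏ c : ZMod p, g (expSum ζ (fun t => (a : ZMod p) * t ^ 3 + c * t)) =
      (∏ c : ZMod p, g (expSum ζ (fun t => t ^ 3 + c * t))) ^ (p - 1) := by
  have hcop : (Nat.card (ZMod p)ˣ).Coprime 3 := by
    rw [Nat.card_eq_fintype_card, ZMod.card_units, Nat.coprime_comm,
      Nat.Prime.coprime_iff_not_dvd Nat.prime_three]
    omega
  have h : ∀ a : (ZMod p)ˣ,
      ∏ c : ZMod p, g (expSum ζ (fun t => (a : ZMod p) * t ^ 3 + c * t)) =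
      ∏ c : ZMod p, g (expSum ζ (fun t => t ^ 3 + c * t)) := by
    intro a
    obtain ⟨b, rfl⟩ := (powCoprime hcop).surjective a
    have hb : ∀ c : ZMod p, expSum ζ (fun t => ((powCoprime hcop b : (ZMod p)ˣ) : ZMod p) * t ^ 3 +
        c * t) = expSum ζ (fun t => t ^ 3 + c * ((b⁻¹ : (ZMod p)ˣ) : ZMod p) * t) := by
      intro c
      have := expSum_mul_cube ζ 1 b c
      simp only [one_mul, Units.val_one] at this
      exact this
    simp only [hb]
    exact Equiv.prod_comp (Units.mulRight b⁻¹) fun c => g (expSum ζ (fun t => t ^ 3 + c * t))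
  rw [Finset.prod_congr rfl fun a _ => h a, Finset.prod_const, Finset.card_univ, ZMod.card_units]

theorem expSum_cube_eq_zero_of_mod_three_eq_two (h3 : p % 3 = 2) {ζ : ℂ}
    (hζ : IsPrimitiveRoot ζ p) : expSum ζ (fun t : ZMod p => t ^ 3) = 0 := by
  have hbij : Function.Bijective fun t : ZMod p => t ^ 3 := by
    rw [← Finite.injective_iff_bijective]
    obtain ⟨k, hk⟩ : ∃ k, 3 * k = (p - 1) + (p - 1) + 1 := ⟨(2 * p - 1) / 3, by omega⟩
    -- `k` inverts `3` modulo `p - 1`.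
    have hinv : ∀ t : ZMod p, (t ^ 3) ^ k = t := by
      intro t
      rw [← pow_mul, hk]
      rcases eq_or_ne t 0 with rfl | ht
      · exact zero_pow (by omega)
      · rw [pow_succ, pow_add, ZMod.pow_card_sub_one_eq_one ht, one_mul, one_mul]
    intro s t h
    rw [← hinv s, ← hinv t]
    exact congrArg (· ^ k) h
  have h1 := expSum_comp_equiv ζ id (Equiv.ofBijective _ hbij)
  have h2 : expSum ζ (id : ZMod p → ZMod p) = 0 := by
    have hψ := AddChar.zmodChar_primitive_of_primitive_root p hζ
    have := hψ.sum_mul_apply_eq_ite 1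
    simpa [AddChar.zmodChar_apply, expSum] using this
  rw [h2] at h1
  exact h1

theorem phiGamma4_zmod_eq_of_mod_three_eq_two (hodd : Odd p) (h3 : p % 3 = 2) {ζ : ℂ}
    (hζ : IsPrimitiveRoot ζ p) :
    phiGamma4 (ZMod p) = X ^ (3 * p * (p - 1)) * (X - C ((p : ℂ) * ((p : ℂ) - 1))) *
      (X - C (p : ℂ)) ^ (p * (p - 1) ^ 2) * (X + C (p : ℂ)) ^ (p - 1 + p * (p - 1) ^ 2) *
      (∏ c : ZMod p, (X + C (p : ℂ) - C (expSum ζ (fun t => t ^ 3 + c * t) ^ 2))) ^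
          (p * (p - 1) ^ 2) := by
  rw [phiGamma4_zmod_eq_of_ne_three hodd (by omega) hζ,
    prod_expSum_of_mod_three_eq_two h3 ζ fun z => X + C (p : ℂ) - C (z ^ 2), ← pow_mul]
  congr 2
  ring

theorem phiGamma4_zmod_eq_prod_units_of_mod_three_eq_two (hodd : Odd p) (h3 : p % 3 = 2) {ζ : ℂ}
    (hζ : IsPrimitiveRoot ζ p) :
    phiGamma4 (ZMod p) =
        X ^ (3 * p * (p - 1)) * (X - C ((p : ℂ) * ((p : ℂ) - 1))) *
          (X - C (p : ℂ)) ^ (p * (p - 1) ^ 2) *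
          (X + C (p : ℂ)) ^ ((p - 1) * (2 * p ^ 2 - 2 * p + 1)) *
          ∏ c : (ZMod p)ˣ,
            (X + C (p : ℂ) - C (expSum ζ (fun t : ZMod p => t ^ 3 + (c : ZMod p) * t) ^ 2)) ^
              (p * (p - 1) ^ 2) := by
  have hp := (Fact.out : p.Prime).two_le
  rw [phiGamma4_zmod_eq_of_mod_three_eq_two hodd h3 hζ, Fintype.prod_eq_mul_prod_units]
  simp only [zero_mul, add_zero, expSum_cube_eq_zero_of_mod_three_eq_two h3 hζ, ne_eq,
    OfNat.ofNat_ne_zero, not_false_eq_true, zero_pow, map_zero, sub_zero]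
  rw [Finset.prod_pow, mul_pow, ← mul_assoc, mul_assoc _ _ ((X + C (p : ℂ)) ^ (p * (p - 1) ^ 2)),
    ← pow_add]
  congr 3
  obtain ⟨n, rfl⟩ : ∃ n, p = n + 1 := ⟨p - 1, by omega⟩
  have e : 2 * (n + 1) ^ 2 - 2 * (n + 1) = 2 * n * (n + 1) := by
    rw [Nat.sub_eq_iff_eq_add (by nlinarith)]
    ring
  rw [e, Nat.add_sub_cancel]
  ring

/-- If `3 ∣ p - 1`, the cubes have index `3` in the unit group. -/
theorem prod_units_of_mul_cube {M : Type*} [CommMonoid M] (h3 : p % 3 = 1) {ω : (ZMod p)ˣ}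
    (hω : ∀ u : (ZMod p)ˣ, u ∈ Subgroup.zpowers ω) (h : (ZMod p)ˣ → M)
    (hcube : ∀ a b, h (a * b ^ 3) = h a) :
    ∏ a, h a = (∏ i : Fin 3, h (ω ^ (i : ℕ))) ^ ((p - 1) / 3) := by
  have hord : orderOf ω = p - 1 := by
    rw [orderOf_eq_card_of_forall_mem_zpowers hω, Nat.card_eq_fintype_card, ZMod.card_units]
  rw [← IsCyclic.image_range_orderOf hω, Finset.prod_image (by
    intro i hi j hj hij
    exact pow_injOn_Iio_orderOf (by simpa using hi) (by simpa using hj) hij), hord]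
  obtain ⟨m, hm⟩ : ∃ m, p - 1 = 3 * m := ⟨(p - 1) / 3, by omega⟩
  have hm' : (p - 1) / 3 = m := by omega
  rw [hm', hm]
  clear hm hm'
  induction m with
  | zero => simp
  | succ m ih =>
    have e : ∀ i, h (ω ^ (3 * m + i)) = h (ω ^ i) := by
      intro i
      rw [pow_add, mul_comm, mul_comm 3 m, pow_mul, hcube]
    rw [mul_add, mul_one, Finset.prod_range_add, ih, pow_succ, Fin.prod_univ_three]
    simp only [e, Finset.prod_range_succ, Finset.prod_range_zero, one_mul]
    rfl

theorem phiGamma4_zmod_eq_of_mod_three_eq_one (hodd : Odd p) (h3 : p % 3 = 1) {ζ : ℂ}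
    (hζ : IsPrimitiveRoot ζ p) {ω : (ZMod p)ˣ} (hω : ∀ u : (ZMod p)ˣ, u ∈ Subgroup.zpowers ω) :
    phiGamma4 (ZMod p) =
        X ^ (3 * p * (p - 1)) * (X - C ((p : ℂ) * ((p : ℂ) - 1))) *
          (X - C (p : ℂ)) ^ (p * (p - 1) ^ 2) *
          (X + C (p : ℂ)) ^ ((p - 1) * (p ^ 2 - p + 1)) *
          (∏ i : Fin 3,
            (X + C (p : ℂ) -
              C (expSum ζ (fun t : ZMod p => (ω : ZMod p) ^ (i : ℕ) * t ^ 3) ^ 2))) ^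
            (p * (p - 1) ^ 2 / 3) *
          ∏ a : (ZMod p)ˣ,
            (X + C (p : ℂ) - C (expSum ζ (fun t : ZMod p => (a : ZMod p) * t ^ 3 + t) ^ 2)) ^
              (p * (p - 1) ^ 2) := by
  have hp := (Fact.out : p.Prime).two_le
  let g : ℂ → ℂ[X] := fun z => X + C (p : ℂ) - C (z ^ 2)
  have h0 : ∏ a : (ZMod p)ˣ, g (expSum ζ (fun t => (a : ZMod p) * t ^ 3 + 0 * t)) =
      (∏ i : Fin 3, g (expSum ζ (fun t : ZMod p => (ω : ZMod p) ^ (i : ℕ) * t ^ 3))) ^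
        ((p - 1) / 3) := by
    rw [prod_units_of_mul_cube h3 hω
      (fun a : (ZMod p)ˣ => g (expSum ζ (fun t => (a : ZMod p) * t ^ 3 + 0 * t))) (by
        intro a b
        rw [expSum_mul_cube, zero_mul])]
    simp
  have h1 : ∏ a : (ZMod p)ˣ, ∏ c : (ZMod p)ˣ,
      g (expSum ζ (fun t => (a : ZMod p) * t ^ 3 + (c : ZMod p) * t)) =
      (∏ a : (ZMod p)ˣ, g (expSum ζ (fun t => (a : ZMod p) * t ^ 3 + t))) ^ (p - 1) := by
    have : ∀ c : (ZMod p)ˣ, ∏ a : (ZMod p)ˣ,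
        g (expSum ζ (fun t => (a : ZMod p) * t ^ 3 + (c : ZMod p) * t)) =
        ∏ a : (ZMod p)ˣ, g (expSum ζ (fun t => (a : ZMod p) * t ^ 3 + t)) := by
      intro c
      rw [← Equiv.prod_comp (Equiv.mulRight (c ^ 3))]
      refine Finset.prod_congr rfl fun a _ => ?_
      rw [Equiv.coe_mulRight, expSum_mul_cube, Units.mul_inv]
      simp only [one_mul]
    rw [Finset.prod_comm, Finset.prod_congr rfl fun c _ => this c, Finset.prod_const,
      Finset.card_univ, ZMod.card_units]
  have hsplit : ∏ a : (ZMod p)ˣ, ∏ c : ZMod p,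
      (X + C (p : ℂ) - C (expSum ζ (fun t => (a : ZMod p) * t ^ 3 + c * t) ^ 2)) =
      (∏ i : Fin 3, g (expSum ζ (fun t : ZMod p => (ω : ZMod p) ^ (i : ℕ) * t ^ 3))) ^
        ((p - 1) / 3) *
      (∏ a : (ZMod p)ˣ, g (expSum ζ (fun t => (a : ZMod p) * t ^ 3 + t))) ^ (p - 1) := by
    rw [← h0, ← h1, ← Finset.prod_mul_distrib]
    exact Finset.prod_congr rfl fun a _ =>
      Fintype.prod_eq_mul_prod_units fun c : ZMod p =>
        g (expSum ζ (fun t => (a : ZMod p) * t ^ 3 + c * t))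
  rw [phiGamma4_zmod_eq_of_ne_three hodd (by omega) hζ, hsplit, Finset.prod_pow, mul_pow,
    ← pow_mul, ← pow_mul, ← mul_assoc]
  have e1 : (p - 1) / 3 * (p * (p - 1)) = p * (p - 1) ^ 2 / 3 := by
    obtain ⟨m, hm⟩ : ∃ m, p - 1 = 3 * m := ⟨(p - 1) / 3, by omega⟩
    have e : p * (3 * m) ^ 2 = 3 * (m * (p * (3 * m))) := by ring
    rw [hm, e, Nat.mul_div_cancel_left _ (by norm_num), Nat.mul_div_cancel_left _ (by norm_num)]
  have e2 : (p - 1) * (p * (p - 1)) = p * (p - 1) ^ 2 := by ring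
  have e3 : p - 1 + p * (p - 1) ^ 2 = (p - 1) * (p ^ 2 - p + 1) := by
    obtain ⟨n, rfl⟩ : ∃ n, p = n + 1 := ⟨p - 1, by omega⟩
    have e : (n + 1) ^ 2 - (n + 1) = n * (n + 1) := by
      rw [Nat.sub_eq_iff_eq_add (by nlinarith)]
      ring
    rw [e, Nat.add_sub_cancel]
    ring
  rw [e1, e2, e3]

end Prime

/-! ### The exceptional primes -/

section SmallPrimes

/-- The `p₁`-frequency `η` only conjugates the block by a diagonal matrix. -/
theorem charpoly_cubicBlock_eq_zero_frequency {F : Type*} [Field F] [Fintype F] [DecidableEq F]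
    (ψ : AddChar F ℂ) (γ δ η : F) (q : ℂ) :
    (cubicBlock ψ γ δ η - q • (1 : Matrix F F ℂ)).charpoly =
      (cubicBlock ψ γ δ 0 - q • (1 : Matrix F F ℂ)).charpoly := by
  refine Matrix.charpoly_eq_of_mul_eq_mul (V := Matrix.diagonal fun v => ψ (-(η * v)))
    (W := Matrix.diagonal fun v => ψ (η * v)) (c := 1) one_ne_zero ?_ ?_
  · rw [Matrix.diagonal_mul_diagonal, one_smul, ← Matrix.diagonal_one]
    congr 1
    funext v
    rw [← AddChar.map_add_eq_mul, neg_add_cancel, AddChar.map_zero_eq_one]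
  · rw [Matrix.sub_mul, Matrix.mul_sub, Matrix.smul_mul, Matrix.mul_smul, Matrix.one_mul,
      Matrix.mul_one]
    congr 1
    ext w v
    rw [Matrix.mul_diagonal, Matrix.diagonal_mul, cubicBlock, cubicBlock, Finset.sum_mul,
      Finset.mul_sum]
    refine Finset.sum_congr rfl fun t _ => ?_
    rw [← AddChar.map_add_eq_mul, ← AddChar.map_add_eq_mul]
    congr 1
    ring

theorem charpoly_fin_three_of_diag_eq_zero {T : Matrix (Fin 3) (Fin 3) ℂ} {s d : ℂ}
    (h0 : T 0 0 = 0) (h1 : T 1 1 = 0) (h2 : T 2 2 = 0)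
    (hs : T 0 1 * T 1 0 + T 0 2 * T 2 0 + T 1 2 * T 2 1 = s)
    (hd : T 0 1 * T 1 2 * T 2 0 + T 0 2 * T 1 0 * T 2 1 = d) :
    T.charpoly = X ^ 3 - C s * X - C d := by
  rw [Matrix.charpoly, Matrix.det_fin_three, ← hs, ← hd]
  simp [h0, h1, h2]
  ring

/-- In characteristic `3` the cube cannot be completed. The block is a `3 × 3` matrix with entries
`2 + ζ^{±1}` and `1 + 2ζ^{±1}` off the diagonal. -/
theorem charpoly_cubicBlock_three {ζ : ℂ} (hζ : IsPrimitiveRoot ζ 3)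
    (γ δ : (ZMod 3)ˣ) (η : ZMod 3) :
    (cubicBlock (AddChar.zmodChar 3 hζ.pow_eq_one) (γ : ZMod 3) (δ : ZMod 3) η -
      (3 : ℂ) • (1 : Matrix (ZMod 3) (ZMod 3) ℂ)).charpoly = X ^ 3 - C 9 * X - C 9 := by
  have hζ2 : ζ ^ 2 = -1 - ζ := by
    have h := hζ.geom_sum_eq_zero (by norm_num)
    simp only [Finset.sum_range_succ, Finset.sum_range_zero] at h
    linear_combination h
  have hentry : ∀ γ δ w v : ZMod 3, cubicBlock (AddChar.zmodChar 3 hζ.pow_eq_one) γ δ 0 w v =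
      ζ ^ (γ * (v ^ 2 - w ^ 2) * 0 + δ * (v - w) * 0 ^ 2 + 0 * (v - w)).val +
      ζ ^ (γ * (v ^ 2 - w ^ 2) * 1 + δ * (v - w) * 1 ^ 2 + 0 * (v - w)).val +
      ζ ^ (γ * (v ^ 2 - w ^ 2) * 2 + δ * (v - w) * 2 ^ 2 + 0 * (v - w)).val :=
    fun γ δ w v => Fin.sum_univ_three _
  have hunit : ∀ u : (ZMod 3)ˣ, (u : ZMod 3) = 1 ∨ (u : ZMod 3) = 2 := by decide
  rw [charpoly_cubicBlock_eq_zero_frequency]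
  have hsub : ∀ w v : ZMod 3, (cubicBlock (AddChar.zmodChar 3 hζ.pow_eq_one) (γ : ZMod 3) δ 0 -
      (3 : ℂ) • (1 : Matrix (ZMod 3) (ZMod 3) ℂ)) w v =
      cubicBlock (AddChar.zmodChar 3 hζ.pow_eq_one) (γ : ZMod 3) δ 0 w v -
        if w = v then 3 else 0 := by
    intro w v
    rw [Matrix.sub_apply, Matrix.smul_apply, Matrix.one_apply]
    split_ifs <;> simp
  -- The entries for `δ = 1` and `δ = 2` are exchanged by `ζ ↦ ζ²`; they do not depend on `γ`.
  obtain ⟨x, y, hxy, hx, h01, h10, h02, h20, h12, h21⟩ : ∃ x y : ℂ, y = -1 - x ∧ x ^ 2 = -1 - x ∧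
      cubicBlock (AddChar.zmodChar 3 hζ.pow_eq_one) (γ : ZMod 3) δ 0 0 1 = 2 + y ∧
      cubicBlock (AddChar.zmodChar 3 hζ.pow_eq_one) (γ : ZMod 3) δ 0 1 0 = 2 + x ∧
      cubicBlock (AddChar.zmodChar 3 hζ.pow_eq_one) (γ : ZMod 3) δ 0 0 2 = 2 + x ∧
      cubicBlock (AddChar.zmodChar 3 hζ.pow_eq_one) (γ : ZMod 3) δ 0 2 0 = 2 + y ∧
      cubicBlock (AddChar.zmodChar 3 hζ.pow_eq_one) (γ : ZMod 3) δ 0 1 2 = 1 + 2 * x ∧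
      cubicBlock (AddChar.zmodChar 3 hζ.pow_eq_one) (γ : ZMod 3) δ 0 2 1 = 1 + 2 * y := by
    simp only [hentry]
    rcases hunit δ with hδ | hδ <;> rcases hunit γ with hγ | hγ <;> rw [hγ, hδ]
    · refine ⟨ζ ^ 1, ζ ^ 2, by linear_combination hζ2, by linear_combination hζ2,
        ?_, ?_, ?_, ?_, ?_, ?_⟩
      · change ζ ^ 0 + ζ ^ 2 + ζ ^ 0 = _; ring
      · change ζ ^ 0 + ζ ^ 1 + ζ ^ 0 = _; ring
      · change ζ ^ 0 + ζ ^ 0 + ζ ^ 1 = _; ring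
      · change ζ ^ 0 + ζ ^ 0 + ζ ^ 2 = _; ring
      · change ζ ^ 0 + ζ ^ 1 + ζ ^ 1 = _; ring
      · change ζ ^ 0 + ζ ^ 2 + ζ ^ 2 = _; ring
    · refine ⟨ζ ^ 1, ζ ^ 2, by linear_combination hζ2, by linear_combination hζ2,
        ?_, ?_, ?_, ?_, ?_, ?_⟩
      · change ζ ^ 0 + ζ ^ 0 + ζ ^ 2 = _; ring
      · change ζ ^ 0 + ζ ^ 0 + ζ ^ 1 = _; ring
      · change ζ ^ 0 + ζ ^ 1 + ζ ^ 0 = _; ring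
      · change ζ ^ 0 + ζ ^ 2 + ζ ^ 0 = _; ring
      · change ζ ^ 0 + ζ ^ 1 + ζ ^ 1 = _; ring
      · change ζ ^ 0 + ζ ^ 2 + ζ ^ 2 = _; ring
    · refine ⟨ζ ^ 2, ζ ^ 1, by linear_combination hζ2,
        by linear_combination (ζ ^ 2 - ζ + 1) * hζ2, ?_, ?_, ?_, ?_, ?_, ?_⟩
      · change ζ ^ 0 + ζ ^ 0 + ζ ^ 1 = _; ring
      · change ζ ^ 0 + ζ ^ 0 + ζ ^ 2 = _; ring
      · change ζ ^ 0 + ζ ^ 2 + ζ ^ 0 = _; ring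
      · change ζ ^ 0 + ζ ^ 1 + ζ ^ 0 = _; ring
      · change ζ ^ 0 + ζ ^ 2 + ζ ^ 2 = _; ring
      · change ζ ^ 0 + ζ ^ 1 + ζ ^ 1 = _; ring
    · refine ⟨ζ ^ 2, ζ ^ 1, by linear_combination hζ2,
        by linear_combination (ζ ^ 2 - ζ + 1) * hζ2, ?_, ?_, ?_, ?_, ?_, ?_⟩
      · change ζ ^ 0 + ζ ^ 1 + ζ ^ 0 = _; ring
      · change ζ ^ 0 + ζ ^ 2 + ζ ^ 0 = _; ring
      · change ζ ^ 0 + ζ ^ 0 + ζ ^ 2 = _; ring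
      · change ζ ^ 0 + ζ ^ 0 + ζ ^ 1 = _; ring
      · change ζ ^ 0 + ζ ^ 2 + ζ ^ 2 = _; ring
      · change ζ ^ 0 + ζ ^ 1 + ζ ^ 1 = _; ring
  have hdiag : ∀ w : ZMod 3, (cubicBlock (AddChar.zmodChar 3 hζ.pow_eq_one) (γ : ZMod 3) δ 0 -
      (3 : ℂ) • (1 : Matrix (ZMod 3) (ZMod 3) ℂ)) w w = 0 := by
    intro w
    rw [hsub, hentry]
    simp
    norm_num
  have hoff : ∀ w v : ZMod 3, w ≠ v →
      (cubicBlock (AddChar.zmodChar 3 hζ.pow_eq_one) (γ : ZMod 3) δ 0 -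
      (3 : ℂ) • (1 : Matrix (ZMod 3) (ZMod 3) ℂ)) w v =
      cubicBlock (AddChar.zmodChar 3 hζ.pow_eq_one) (γ : ZMod 3) δ 0 w v := by
    intro w v hwv
    rw [hsub, if_neg hwv, sub_zero]
  refine charpoly_fin_three_of_diag_eq_zero (hdiag 0) (hdiag 1) (hdiag 2) ?_ ?_
  · refine Eq.trans (congrArg₂ (· + ·) (congrArg₂ (· + ·) (congrArg₂ (· * ·)
      ((hoff 0 1 (by decide)).trans h01) ((hoff 1 0 (by decide)).trans h10)) (congrArg₂ (· * ·)
      ((hoff 0 2 (by decide)).trans h02) ((hoff 2 0 (by decide)).trans h20))) (congrArg₂ (· * ·)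
      ((hoff 1 2 (by decide)).trans h12) ((hoff 2 1 (by decide)).trans h21))) ?_
    simp only [hxy]
    linear_combination (-6) * hx
  · refine Eq.trans (congrArg₂ (· + ·) (congrArg₂ (· * ·) (congrArg₂ (· * ·)
      ((hoff 0 1 (by decide)).trans h01) ((hoff 1 2 (by decide)).trans h12))
      ((hoff 2 0 (by decide)).trans h20)) (congrArg₂ (· * ·) (congrArg₂ (· * ·)
      ((hoff 0 2 (by decide)).trans h02) ((hoff 1 0 (by decide)).trans h10))
      ((hoff 2 1 (by decide)).trans h21))) ?_
    simp only [hxy]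
    linear_combination (-12) * hx

theorem phiGamma4_zmod_three : phiGamma4 (ZMod 3) =
    X ^ 18 * (X - C 6) * (X - C 3) ^ 12 * (X + C 3) ^ 14 * (X ^ 3 - C 9 * X - C 9) ^ 12 := by
  have hζ := Complex.isPrimitiveRoot_exp 3 (by norm_num)
  have hψ := AddChar.zmodChar_primitive_of_primitive_root 3 hζ
  rw [phiGamma4_zmod_eq (by decide) hψ]
  simp only [Nat.cast_ofNat]
  rw [Finset.prod_congr rfl fun γ _ => Finset.prod_congr rfl fun δ _ =>
    Finset.prod_congr rfl fun η _ => charpoly_cubicBlock_three hζ γ δ η]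
  simp only [Finset.prod_const, Finset.card_univ, ZMod.card_units, ZMod.card, ← pow_mul]
  norm_num

/-- The five sums lie in `ℚ(√5)`. Those with `c = 2, 3` have square `5` and contribute the
additional factor `X²`. -/
theorem prod_expSum_five [Fact (Nat.Prime 5)] {ζ : ℂ} (hζ : IsPrimitiveRoot ζ 5) :
    ∏ c : ZMod 5, (X + C 5 - C (expSum ζ (fun t : ZMod 5 => t ^ 3 + c * t) ^ 2)) =
      (X + C 5) * X ^ 2 * (X ^ 2 - C 5 * X - C 25) := by
  have h := hζ.geom_sum_eq_zero (by norm_num)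
  simp only [Finset.sum_range_succ, Finset.sum_range_zero, pow_zero, pow_one, zero_add] at h
  have hsum : ∀ f : ZMod 5 → ZMod 5, expSum ζ f = ζ ^ (f 0).val + ζ ^ (f 1).val + ζ ^ (f 2).val +
      ζ ^ (f 3).val + ζ ^ (f 4).val := fun f => Fin.sum_univ_five _
  have e0 : expSum ζ (fun t : ZMod 5 => t ^ 3 + 0 * t) = 0 := by
    rw [hsum]
    change ζ ^ 0 + ζ ^ 1 + ζ ^ 3 + ζ ^ 2 + ζ ^ 4 = 0
    linear_combination h
  have e1 : expSum ζ (fun t : ZMod 5 => t ^ 3 + 1 * t) = 3 + (ζ ^ 2 + ζ ^ 3) := by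
    rw [hsum]
    change ζ ^ 0 + ζ ^ 2 + ζ ^ 0 + ζ ^ 0 + ζ ^ 3 = _
    ring
  have e2 : expSum ζ (fun t : ZMod 5 => t ^ 3 + 2 * t) = 1 + 2 * (ζ ^ 2 + ζ ^ 3) := by
    rw [hsum]
    change ζ ^ 0 + ζ ^ 3 + ζ ^ 2 + ζ ^ 3 + ζ ^ 2 = _
    ring
  have e3 : expSum ζ (fun t : ZMod 5 => t ^ 3 + 3 * t) = -1 - 2 * (ζ ^ 2 + ζ ^ 3) := by
    rw [hsum]
    change ζ ^ 0 + ζ ^ 4 + ζ ^ 4 + ζ ^ 1 + ζ ^ 1 = _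
    linear_combination 2 * h
  have e4 : expSum ζ (fun t : ZMod 5 => t ^ 3 + 4 * t) = 2 - (ζ ^ 2 + ζ ^ 3) := by
    rw [hsum]
    change ζ ^ 0 + ζ ^ 0 + ζ ^ 1 + ζ ^ 4 + ζ ^ 0 = _
    linear_combination h
  have h5 := hζ.pow_eq_one
  -- `τ` is a Gaussian period, a root of `τ² + τ - 1`.
  generalize hτ : ζ ^ 2 + ζ ^ 3 = τ at e1 e2 e3 e4
  have hτ2 : τ ^ 2 + τ = 1 := by
    rw [← hτ]
    linear_combination h + (2 + ζ) * h5
  have hC : (C τ ^ 2 + C τ : ℂ[X]) = 1 := by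
    rw [← C_pow, ← C_add, hτ2, C_1]
  refine (Fin.prod_univ_five _).trans ?_
  change (X + C 5 - C (expSum ζ (fun t : ZMod 5 => t ^ 3 + 0 * t) ^ 2)) *
    (X + C 5 - C (expSum ζ (fun t : ZMod 5 => t ^ 3 + 1 * t) ^ 2)) *
    (X + C 5 - C (expSum ζ (fun t : ZMod 5 => t ^ 3 + 2 * t) ^ 2)) *
    (X + C 5 - C (expSum ζ (fun t : ZMod 5 => t ^ 3 + 3 * t) ^ 2)) *
    (X + C 5 - C (expSum ζ (fun t : ZMod 5 => t ^ 3 + 4 * t) ^ 2)) = _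
  have s1 : (3 + τ) ^ 2 = 10 + 5 * τ := by linear_combination hτ2
  have s2 : (1 + 2 * τ) ^ 2 = 5 := by linear_combination 4 * hτ2
  have s3 : (-1 - 2 * τ) ^ 2 = 5 := by linear_combination 4 * hτ2
  have s4 : (2 - τ) ^ 2 = 5 - 5 * τ := by linear_combination hτ2
  rw [e0, e1, e2, e3, e4, s1, s2, s3, s4]
  simp only [map_add, map_sub, map_mul, map_ofNat, ne_eq, OfNat.ofNat_ne_zero, not_false_eq_true,
    zero_pow, map_zero, sub_zero]
  linear_combination (-25) * (X + 5) * X ^ 2 * hC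

theorem phiGamma4_zmod_five [Fact (Nat.Prime 5)] : phiGamma4 (ZMod 5) =
    X ^ 220 * (X - C 20) * (X - C 5) ^ 80 * (X + C 5) ^ 164 * (X ^ 2 - C 5 * X - C 25) ^ 80 := by
  obtain ⟨ζ, hζ⟩ : ∃ ζ : ℂ, IsPrimitiveRoot ζ 5 :=
    ⟨_, Complex.isPrimitiveRoot_exp 5 (by norm_num)⟩
  rw [phiGamma4_zmod_eq_of_mod_three_eq_two (by decide) (by norm_num) hζ]
  simp only [Nat.cast_ofNat]
  rw [prod_expSum_five hζ]
  have h20 : (5 * (5 - 1) : ℂ) = 20 := by norm_num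
  rw [h20]
  have key : ∀ a b c d x : ℂ[X], x ^ 60 * a * b ^ 80 * c ^ 84 * (c * x ^ 2 * d) ^ 80 =
      x ^ 220 * a * b ^ 80 * c ^ 164 * d ^ 80 := by
    intro a b c d x
    ring
  rw [show 3 * 5 * (5 - 1) = 60 from rfl, show 5 * (5 - 1) ^ 2 = 80 from rfl,
    show 5 - 1 + 80 = 84 from rfl]
  rw [key]

end SmallPrimes

/-! ### The spectrum -/

section Spectrum

variable {p : ℕ}

/-- The candidates for the distinct roots of `φ`: the four integers `0`, `p(p-1)`, `p`, `-p`,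
followed by the numbers `e j ^ 2 - p` for a family `e` of exponential sums. -/
noncomputable def spectrumRoot (p : ℕ) {J : Type*} (e : J → ℂ) : Fin 4 ⊕ J → ℂ :=
  Sum.elim ![0, (p : ℂ) * ((p : ℂ) - 1), p, -p] fun j => e j ^ 2 - p

/-- Each of the four integers is congruent to `0` modulo `p`, so it suffices that no square
`e j ^ 2` is an integer multiple of `p`. -/
theorem spectrumRoot_injective (hp : 2 < p) {J : Type*} {e : J → ℂ}
    (he : ∀ i j, e i ^ 2 = e j ^ 2 → i = j) (hne : ∀ j (m : ℤ), e j ^ 2 ≠ p * m) :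
    Function.Injective (spectrumRoot p e) := by
  have hp' : (2 : ℝ) < p := by exact_mod_cast hp
  -- The four integers are compared in the ordered field `ℝ`.
  have h4 : Function.Injective (![0, (p : ℂ) * ((p : ℂ) - 1), p, -p] : Fin 4 → ℂ) := by
    have hcast : (![0, (p : ℂ) * ((p : ℂ) - 1), p, -p] : Fin 4 → ℂ) =
        fun i => (((![0, (p : ℝ) * ((p : ℝ) - 1), p, -p] : Fin 4 → ℝ) i : ℝ) : ℂ) := by
      funext i
      fin_cases i <;> simp
    rw [hcast]
    refine Complex.ofReal_injective.comp ?_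
    intro i j hij
    fin_cases i <;> fin_cases j <;> simp [-mul_eq_zero, -zero_eq_mul] at hij ⊢ <;>
      nlinarith
  refine h4.sumElim (fun i j h => he i j (sub_left_injective h)) fun i j h => ?_
  have h' : e j ^ 2 = (![0, (p : ℂ) * ((p : ℂ) - 1), p, -p] : Fin 4 → ℂ) i + p :=
    (sub_eq_iff_eq_add.1 h.symm)
  fin_cases i
  · exact hne j 1 (by rw [h']; simp)
  · exact hne j p (by rw [h']; simp; ring)
  · exact hne j 2 (by rw [h']; simp; ring)
  · exact hne j 0 (by rw [h']; simp)

theorem prod_spectrumRoot {J : Type*} [Fintype J] (e : J → ℂ) (n : Fin 4 → ℕ) (m : J → ℕ) :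
    ∏ i, (X - C (spectrumRoot p e i)) ^ (Sum.elim n m i) =
      X ^ n 0 * (X - C ((p : ℂ) * ((p : ℂ) - 1))) ^ n 1 * (X - C (p : ℂ)) ^ n 2 *
        (X + C (p : ℂ)) ^ n 3 * ∏ j, (X + C (p : ℂ) - C (e j ^ 2)) ^ m j := by
  have h : ∀ j, (X - C (e j ^ 2 - p) : ℂ[X]) = X + C (p : ℂ) - C (e j ^ 2) := by
    intro j
    rw [map_sub]
    ring
  rw [Fintype.prod_sum_type, Fin.prod_univ_four]
  simp only [spectrumRoot, Sum.elim_inl, Sum.elim_inr, h]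
  simp

end Spectrum

theorem theorem7p5 (p : ℕ) [Fact p.Prime] (_hodd : Odd p) :
    (p = 3 → phiGamma4 (ZMod p) =
      X ^ 18 * (X - C 6) * (X - C 3) ^ 12 * (X + C 3) ^ 14 * (X ^ 3 - C 9 * X - C 9) ^ 12) ∧
    (p = 5 → phiGamma4 (ZMod p) =
      X ^ 220 * (X - C 20) * (X - C 5) ^ 80 * (X + C 5) ^ 164 *
        (X ^ 2 - C 5 * X - C 25) ^ 80) ∧
    (5 < p → p % 3 = 2 → ∀ ζ : ℂ, IsPrimitiveRoot ζ p →
      phiGamma4 (ZMod p) =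
        X ^ (3 * p * (p - 1)) * (X - C ((p : ℂ) * ((p : ℂ) - 1))) *
          (X - C (p : ℂ)) ^ (p * (p - 1) ^ 2) *
          (X + C (p : ℂ)) ^ ((p - 1) * (2 * p ^ 2 - 2 * p + 1)) *
          ∏ c : (ZMod p)ˣ,
            (X + C (p : ℂ) - C (expSum ζ (fun t : ZMod p => t ^ 3 + (c : ZMod p) * t) ^ 2)) ^
              (p * (p - 1) ^ 2) ∧
      (phiGamma4 (ZMod p)).roots.toFinset.card = p + 3 ∧
      (phiGamma4 (ZMod p)).rootMultiplicity 0 = 3 * p * (p - 1) ∧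
      (phiGamma4 (ZMod p)).rootMultiplicity ((p : ℂ) * ((p : ℂ) - 1)) = 1 ∧
      (phiGamma4 (ZMod p)).rootMultiplicity (p : ℂ) = p * (p - 1) ^ 2 ∧
      (phiGamma4 (ZMod p)).rootMultiplicity (-(p : ℂ)) =
        (p - 1) * (2 * p ^ 2 - 2 * p + 1) ∧
      ∀ c : (ZMod p)ˣ,
        (phiGamma4 (ZMod p)).rootMultiplicity
          (expSum ζ (fun t : ZMod p => t ^ 3 + (c : ZMod p) * t) ^ 2 - (p : ℂ)) =
            p * (p - 1) ^ 2) ∧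
    (p % 3 = 1 → ∀ ζ : ℂ, IsPrimitiveRoot ζ p →
      ∀ ω : (ZMod p)ˣ, (∀ u : (ZMod p)ˣ, u ∈ Subgroup.zpowers ω) →
      phiGamma4 (ZMod p) =
        X ^ (3 * p * (p - 1)) * (X - C ((p : ℂ) * ((p : ℂ) - 1))) *
          (X - C (p : ℂ)) ^ (p * (p - 1) ^ 2) *
          (X + C (p : ℂ)) ^ ((p - 1) * (p ^ 2 - p + 1)) *
          (∏ i : Fin 3,
            (X + C (p : ℂ) -
              C (expSum ζ (fun t : ZMod p => (ω : ZMod p) ^ (i : ℕ) * t ^ 3) ^ 2))) ^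
            (p * (p - 1) ^ 2 / 3) *
          ∏ a : (ZMod p)ˣ,
            (X + C (p : ℂ) - C (expSum ζ (fun t : ZMod p => (a : ZMod p) * t ^ 3 + t) ^ 2)) ^
              (p * (p - 1) ^ 2) ∧
      (phiGamma4 (ZMod p)).roots.toFinset.card = p + 6 ∧
      (phiGamma4 (ZMod p)).rootMultiplicity 0 = 3 * p * (p - 1) ∧
      (phiGamma4 (ZMod p)).rootMultiplicity ((p : ℂ) * ((p : ℂ) - 1)) = 1 ∧
      (phiGamma4 (ZMod p)).rootMultiplicity (p : ℂ) = p * (p - 1) ^ 2 ∧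
      (phiGamma4 (ZMod p)).rootMultiplicity (-(p : ℂ)) = (p - 1) * (p ^ 2 - p + 1) ∧
      (∀ i : Fin 3,
        (phiGamma4 (ZMod p)).rootMultiplicity
          (expSum ζ (fun t : ZMod p => (ω : ZMod p) ^ (i : ℕ) * t ^ 3) ^ 2 - (p : ℂ)) =
            p * (p - 1) ^ 2 / 3) ∧
      ∀ a : (ZMod p)ˣ,
        (phiGamma4 (ZMod p)).rootMultiplicity
          (expSum ζ (fun t : ZMod p => (a : ZMod p) * t ^ 3 + t) ^ 2 - (p : ℂ)) =
            p * (p - 1) ^ 2) := by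
  have hp : p.Prime := Fact.out
  have hp1 : p - 1 ≠ 0 := by
    have := hp.two_le
    omega
  have hp0 : p ≠ 0 := hp.ne_zero
  refine ⟨?_, ?_, ?_, ?_⟩
  · rintro rfl
    exact phiGamma4_zmod_three
  · rintro rfl
    exact phiGamma4_zmod_five
  · intro h5 h3 ζ hζ
    have hphi := phiGamma4_zmod_eq_prod_units_of_mod_three_eq_two _hodd h3 hζ
    refine ⟨hphi, ?_⟩
    let e : (ZMod p)ˣ → ℂ := fun c => expSum ζ (fun t : ZMod p => t ^ 3 + (c : ZMod p) * t)
    let n : Fin 4 → ℕ := ![3 * p * (p - 1), 1, p * (p - 1) ^ 2, (p - 1) * (2 * p ^ 2 - 2 * p + 1)]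
    let m : (ZMod p)ˣ → ℕ := fun _ => p * (p - 1) ^ 2
    have hinj : Function.Injective (spectrumRoot p e) :=
      spectrumRoot_injective (by omega)
        (fun c d h => Units.ext
          (expSum_cubic_sq_injective_of_mod_three_eq_two h5 h3 hζ c.ne_zero h))
        (fun c => expSum_cubic_sq_ne_mul_of_mod_three_eq_two h5 h3 hζ c.ne_zero)
    have hprod : phiGamma4 (ZMod p) = ∏ i, (X - C (spectrumRoot p e i)) ^ (Sum.elim n m i) := by
      rw [hphi, prod_spectrumRoot]
      simp [n, m, e]
    have hpos : ∀ i, Sum.elim n m i ≠ 0 := by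
      rintro (i | c)
      · fin_cases i <;> simp [n, hp0, hp1]
      · simp [m, hp0, hp1]
    have hmult := rootMultiplicity_prod_X_sub_C_pow hinj (Sum.elim n m)
    rw [hprod]
    refine ⟨?_, hmult (Sum.inl 0), hmult (Sum.inl 1), hmult (Sum.inl 2), hmult (Sum.inl 3),
      fun c => hmult (Sum.inr c)⟩
    rw [card_roots_toFinset_prod_X_sub_C_pow hinj hpos, Fintype.card_sum, Fintype.card_fin,
      ZMod.card_units]
    omega
  · intro h3 ζ hζ ω hω
    have hphi := phiGamma4_zmod_eq_of_mod_three_eq_one _hodd h3 hζ hω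
    refine ⟨hphi, ?_⟩
    have hp7 : 7 ≤ p := by
      have h2 := hp.two_le
      have hodd' := Nat.odd_iff.1 _hodd
      omega
    obtain ⟨k, hk⟩ : ∃ k, p = 6 * k + 1 := by
      have hodd' := Nat.odd_iff.1 _hodd
      exact ⟨p / 6, by omega⟩
    have hk1 : (p - 1) / 3 = 2 * k := by omega
    -- The sums with linear term zero and those with linear term `t`, as sums of `at³ + bt`.
    let a : Fin 3 ⊕ (ZMod p)ˣ → (ZMod p)ˣ := Sum.elim (fun i => ω ^ (i : ℕ)) id
    let b : Fin 3 ⊕ (ZMod p)ˣ → ZMod p := Sum.elim (fun _ => 0) fun _ => 1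
    let e : Fin 3 ⊕ (ZMod p)ˣ → ℂ := fun j =>
      expSum ζ (fun t : ZMod p => (a j : ZMod p) * t ^ 3 + b j * t)
    let n : Fin 4 → ℕ := ![3 * p * (p - 1), 1, p * (p - 1) ^ 2, (p - 1) * (p ^ 2 - p + 1)]
    let m : Fin 3 ⊕ (ZMod p)ˣ → ℕ :=
      Sum.elim (fun _ => p * (p - 1) ^ 2 / 3) fun _ => p * (p - 1) ^ 2
    have hsep : ∀ i j, e i ^ 2 = e j ^ 2 → i = j := by
      intro i j h
      obtain ⟨h1, h2⟩ := pow_eq_pow_of_expSum_cubic_sq_eq h3 hζ (a i).ne_zero (a j).ne_zero h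
      rw [hk1] at h1 h2
      rcases i with i | i <;> rcases j with j | j
      · have h1' : ω ^ ((i : ℕ) * (2 * k)) = ω ^ ((j : ℕ) * (2 * k)) := by
          rw [pow_mul ω i, pow_mul ω j]
          exact Units.ext (by simpa [a] using h1)
        have hord : orderOf ω = p - 1 := by
          rw [orderOf_eq_card_of_forall_mem_zpowers hω, Nat.card_eq_fintype_card, ZMod.card_units]
        have hlt : ∀ i : Fin 3, (i : ℕ) * (2 * k) < orderOf ω := by
          intro i
          have : (i : ℕ) * (2 * k) ≤ 2 * (2 * k) := Nat.mul_le_mul_right _ (by omega)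
          omega
        have h3' := pow_injOn_Iio_orderOf (hlt i) (hlt j) h1'
        exact congrArg Sum.inl (Fin.ext (Nat.eq_of_mul_eq_mul_right (by omega) h3'))
      · have h2' : 0 = (j : ZMod p) ^ (2 * k - 1) := by simpa [a, b] using h2
        exact absurd h2'.symm (pow_ne_zero _ j.ne_zero)
      · simp [a, b] at h2
      · have h1' : i ^ (2 * k) = j ^ (2 * k) := Units.ext (by simpa [a] using h1)
        have h2' : i ^ (2 * k - 1) = j ^ (2 * k - 1) := Units.ext (by simpa [a, b] using h2)
        have hk2 : 2 * k = 2 * k - 1 + 1 := by omega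
        rw [hk2, pow_succ, pow_succ, h2'] at h1'
        exact congrArg Sum.inr (mul_left_cancel h1')
    have hinj : Function.Injective (spectrumRoot p e) :=
      spectrumRoot_injective (by omega) hsep
        fun j => expSum_cubic_sq_ne_mul_of_mod_three_eq_one h3 hζ (a j).ne_zero (b j)
    have hprod : phiGamma4 (ZMod p) = ∏ i, (X - C (spectrumRoot p e i)) ^ (Sum.elim n m i) := by
      rw [hphi, prod_spectrumRoot, Fintype.prod_sum_type, ← Finset.prod_pow, ← mul_assoc]
      simp [n, m, e, a, b]
    have hpos : ∀ i, Sum.elim n m i ≠ 0 := by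
      rintro (i | i | i)
      · fin_cases i <;> simp [n, hp0, hp1]
      · have : 3 ≤ p * (p - 1) ^ 2 := by
          calc 3 ≤ p * 1 := by omega
            _ ≤ p * (p - 1) ^ 2 := Nat.mul_le_mul_left _ (Nat.pos_of_ne_zero (pow_ne_zero 2 hp1))
        simp only [m, Sum.elim_inr, Sum.elim_inl]
        omega
      · simp [m, hp0, hp1]
    have hmult := rootMultiplicity_prod_X_sub_C_pow hinj (Sum.elim n m)
    rw [hprod]
    refine ⟨?_, hmult (Sum.inl 0), hmult (Sum.inl 1), hmult (Sum.inl 2), hmult (Sum.inl 3),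
      fun i => ?_, fun i => ?_⟩
    · rw [card_roots_toFinset_prod_X_sub_C_pow hinj hpos, Fintype.card_sum, Fintype.card_sum,
        Fintype.card_fin, Fintype.card_fin, ZMod.card_units]
      omega
    · have h := hmult (Sum.inr (Sum.inl i))
      simpa [spectrumRoot, e, a, b, m] using h
    · have h := hmult (Sum.inr (Sum.inr i))
      simpa [spectrumRoot, e, a, b, m] using h
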